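/- Let $n\ge 1$, write $[n]=\{1,\dots,n\}$, and let $\lambda=(\lambda_1\ge\dots\ge\lambda_n\ge 0)$ be a partition with $n$ nonnegative integer parts. Let $R_\lambda=\{q_1<\dots<q_r\}\subseteq[n-1]$ be the set of distinct column lengths of the shape $\lambda$ that are less than $n$, and put $q_0=0$, $q_{r+1}=n$. The intervals $\{q_{h-1}+1,\dots,q_h\}$, $1\le h\le r+1$, are called carrels. *Tuples.* An upper tuple is $\beta\in[n]^n$ with $\beta_i\ge i$ for all $i$. Its critical indices in the $h$-th carrel are found from right to left: $q_h$ is critical, and the next critical index to the left of a critical index $x$ is the largest $y<x$ in the same carrel with $\beta_x-\beta_y>x-y$, if it exists. The tuple $\beta$ is a gapless core tuple if for all $1\le h\le r$ one has $\beta_{q_h}\le\beta_k$, where $k$ is the leftmost critical index of the $(h+1)$-st carrel. It is bounded by its platform if $\beta_i\le\beta_x$ for all $i$, where $x$ is the smallest critical index with $x\ge i$. *Polynomials.* Let $s_\lambda(\beta;x)=\sum_T x^{\Theta(T)}$, the sum over the semistandard tableaux $T$ of shape $\lambda$ with values in $[n]$ whose values in row $i$ are at most $\beta_i$ for all $i$,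 where $x^{\Theta(T)}$ is the product of $x_v$ over the values $v$ of $T$. Let $h_u(i,k;x)$ be the complete homogeneous symmetric polynomial of degree $u$ in $x_i,x_{i+1},\dots,x_k$, with $h_u=0$ for $u<0$. The Gessel–Viennot determinant with input $\beta$ is the $n\times n$ determinant $\bigl|h_{\lambda_j-j+i}(i,\beta_j;x)\bigr|$. *Valid inputs.* Consider lattice paths with unit steps $(1,0)$ and $(0,1)$. An upper tuple $\beta$ is a valid input if $(\lambda,\beta)$ is nonpermutable, i.e. if for no permutation $\pi\ne\mathrm{id}$ of $[n]$ are there pairwise disjoint lattice paths $\Lambda_1,\dots,\Lambda_n$ such that $\Lambda_m$ runs from $(n-m,m)$ to $(\lambda_{\pi_m}+n-\pi_m,\beta_{\pi_m})$ for every $m\in[n]$. *Efficiency.* A gapless core tuple $\eta$ that is bounded by its platform attains maximum efficiency if the total number of monomials in the entries of $\bigl|h_{\lambda_j-j+i}(i,\eta_j;x)\bigr|$ is strictly smaller than the corresponding number for every other gapless core tuple $\eta'\neq\eta$ that is bounded by its platform and whose Gessel–Viennot determinant equals $s_\lambda(\eta;x)$. *Parabolic Catalan number.* $C_n^\lambda$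 is the number of $\lambda$-312-avoiding permutations, i.e. of permutations $\pi$ of $[n]$ that are increasing on each carrel and for which there are no $q<q'$ in $R_\lambda$ and indices $a\le q<b\le q'<c$ with $\pi_b<\pi_c<\pi_a$. **Statement.** The number of valid inputs that attain maximum efficiency is $C_n^\lambda$. -/

import Mathlib

/-! Conventions.  All indices, entries, tableau values and latitudes lie in `Fin n = {0, …, n - 1}`
and stand for the elements `1, …, n` of `[n]`, that is, everything is shifted down by one.
Differences such as `β x - β y` or `λ j - j + i` and comparisons are not affected by the shift,
and `β` is upper iff `i ≤ β i`.  Elements `q` of a divider set `R ⊆ {1, …, n - 1}` are not shifted: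
the index `i : Fin n` lies to the left of the divider `q` iff `(i : ℕ) < q`. -/

namespace GVInput

open MvPolynomial

noncomputable section

variable {n : ℕ}

/-! ### Tuples with dividers -/

/-- An upper tuple: `β_i ≥ i` for all `i`. -/
def IsUpper (β : Fin n → Fin n) : Prop :=
  ∀ i, i ≤ β i

/-- Two indices lie in the same carrel if no divider separates them. -/
def SameCarrel (R : Set ℕ) (i k : Fin n) : Prop :=
  ∀ q ∈ R, ((i : ℕ) < q ↔ (k : ℕ) < q)

/-- `x` is the last index of its carrel. -/
def IsCarrelEnd (R : Set ℕ) (x : Fin n) : Prop :=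
  (x : ℕ) + 1 ∈ R ∨ (x : ℕ) + 1 = n

/-- The critical indices of `β`, found within each carrel from right to left: the last index of a
carrel is critical, and the next critical index to the left of a critical index `x` is the largest
`y < x` in the same carrel with `β x - β y > x - y`, if there is one. -/
inductive IsCritical (R : Set ℕ) (β : Fin n → Fin n) : Fin n → Prop
  | last (x : Fin n) : IsCarrelEnd R x → IsCritical R β x
  | next (x y : Fin n) : IsCritical R β x → SameCarrel R y x → y < x →
      ((β x : ℤ) - (β y : ℤ) > (x : ℤ) - (y : ℤ)) →
      (∀ z : Fin n, y < z → z < x → ¬ ((β x : ℤ) - (β z : ℤ) > (x : ℤ) - (z : ℤ))) →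
      IsCritical R β y

open Classical in
theorem critical_from_nonempty (R : Set ℕ) (β : Fin n → Fin n) (i : Fin n) :
    (Finset.univ.filter fun x => i ≤ x ∧ IsCritical R β x).Nonempty := by
  have hi := i.isLt
  refine ⟨⟨n - 1, by omega⟩, ?_⟩
  rw [Finset.mem_filter]
  refine ⟨Finset.mem_univ _, ?_, IsCritical.last _ (Or.inr ?_)⟩
  · rw [Fin.le_def]
    show (i : ℕ) ≤ n - 1
    omega
  · show n - 1 + 1 = n
    omega

open Classical in
/-- The leftmost critical index that is weakly to the right of `i`.  As the last index of the carrel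
of `i` is critical, it lies in the carrel of `i`. -/
def nextCritical (R : Set ℕ) (β : Fin n → Fin n) (i : Fin n) : Fin n :=
  (Finset.univ.filter fun x => i ≤ x ∧ IsCritical R β x).min' (critical_from_nonempty R β i)

/-- The platform `Ξ_R(β)`: its `i`-th entry is the critical entry at the leftmost critical index
weakly to the right of `i`. -/
def platform (R : Set ℕ) (β : Fin n → Fin n) : Fin n → Fin n :=
  fun i => β (nextCritical R β i)

/-- The critical list of `β` is a flag critical list: the entry at the last index `i` of a carrel
other than the last one is at most the leftmost critical entry of the following carrel (whose first
index is `j = i + 1`). -/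
def HasFlagCriticalList (R : Set ℕ) (β : Fin n → Fin n) : Prop :=
  ∀ i j : Fin n, (i : ℕ) + 1 ∈ R → (j : ℕ) = (i : ℕ) + 1 → β i ≤ β (nextCritical R β j)

/-- Gapless core tuples. -/
def IsGaplessCore (R : Set ℕ) (β : Fin n → Fin n) : Prop :=
  IsUpper β ∧ HasFlagCriticalList R β

/-- Upper tuples that are bounded by their platform. -/
def IsBoundedByPlatform (R : Set ℕ) (β : Fin n → Fin n) : Prop :=
  IsUpper β ∧ ∀ i, β i ≤ platform R β i

/-! ### Parabolic Catalan numbers -/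

/-- An `R`-permutation is a permutation, in one-line notation, that increases in each carrel. -/
def IsRPermutation (R : Set ℕ) (π : Equiv.Perm (Fin n)) : Prop :=
  ∀ i k : Fin n, i < k → SameCarrel R i k → π i < π k

/-- `π` contains the pattern 312 at indices `a`, `b`, `c`, with dividers between `a` and `b` and
between `b` and `c`. -/
def Contains312 (R : Set ℕ) (π : Equiv.Perm (Fin n)) : Prop :=
  ∃ q ∈ R, ∃ q' ∈ R, ∃ a b c : Fin n,
    (a : ℕ) < q ∧ q ≤ (b : ℕ) ∧ (b : ℕ) < q' ∧ q' ≤ (c : ℕ) ∧ π b < π c ∧ π c < π a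

/-- The number of `R`-312-avoiding permutations. -/
def parabolicCatalan (n : ℕ) (R : Set ℕ) : ℕ :=
  {π : Equiv.Perm (Fin n) | IsRPermutation R π ∧ ¬ Contains312 R π}.ncard

/-! ### Shapes, tableaux, polynomials -/

/-- The length of the `j`-th column (`j = 0, 1, …`) of the shape with row lengths `lam`. -/
def colLength (lam : Fin n → ℕ) (j : ℕ) : ℕ :=
  (Finset.univ.filter fun i => j < lam i).card

/-- `R_λ`: the set of the lengths of the (nonempty) columns of `λ` that are less than `n`. -/
def dividers (lam : Fin n → ℕ) : Set ℕ :=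
  {q | q < n ∧ ∃ j, (∃ i, j < lam i) ∧ q = colLength lam j}

/-- Fillings of the shape with row lengths `lam` with values from `[n]`; `T i j` is the value in
row `i` and column `j`. -/
abbrev Filling (lam : Fin n → ℕ) : Type :=
  (i : Fin n) → Fin (lam i) → Fin n

/-- Semistandard: weakly increasing along rows and strictly increasing down columns. -/
def IsSemistandard (lam : Fin n → ℕ) (T : Filling lam) : Prop :=
  (∀ i, Monotone (T i)) ∧
    ∀ (i i' : Fin n) (j : ℕ) (hj : j < lam i) (hj' : j < lam i'),
      i < i' → T i ⟨j, hj⟩ < T i' ⟨j, hj'⟩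

/-- The row bound set of tableaux `S_λ(β)`. -/
def rowBoundSet (lam : Fin n → ℕ) (β : Fin n → Fin n) : Set (Filling lam) :=
  {T | IsSemistandard lam T ∧ ∀ i j, T i j ≤ β i}

open Classical in
/-- The row bound sum `s_λ(β; x)`, which is the flagged Schur polynomial if `β` is a flag. -/
def rowBoundSum (lam : Fin n → ℕ) (β : Fin n → Fin n) : MvPolynomial (Fin n) ℤ :=
  ∑ T ∈ Finset.univ.filter (fun T : Filling lam => T ∈ rowBoundSet lam β),
    ∏ i, ∏ j, X (T i j)

/-- `h_u(i, k; x)`: the complete homogeneous symmetric polynomial of degree `u` in the variables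
`x_i, …, x_k`, which is `0` if `u < 0`. -/
def hPoly (u : ℤ) (i k : Fin n) : MvPolynomial (Fin n) ℤ :=
  if 0 ≤ u then
    rename Subtype.val (hsymm {t : Fin n // i ≤ t ∧ t ≤ k} ℤ u.toNat)
  else 0

/-- The matrix of the Gessel–Viennot determinant, with `(i, j)` entry
`h_{λ_j - j + i}(i, β_j; x)`. -/
def gvMatrix (lam : Fin n → ℕ) (β : Fin n → Fin n) :
    Matrix (Fin n) (Fin n) (MvPolynomial (Fin n) ℤ) :=
  Matrix.of fun i j => hPoly ((lam j : ℤ) - (j : ℤ) + (i : ℤ)) i (β j)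

/-- The total number of monomials among the entries of the Gessel–Viennot determinant. -/
def monomialCount (lam : Fin n → ℕ) (β : Fin n → Fin n) : ℕ :=
  ∑ i, ∑ j, (gvMatrix lam β i j).support.card

/-! ### Lattice paths -/

/-- A unit step: easterly (first coordinate) or southerly (second coordinate, the depth). -/
def Step (P Q : ℕ × ℕ) : Prop :=
  Q = (P.1 + 1, P.2) ∨ Q = (P.1, P.2 + 1)

/-- `p` lists the successive lattice points of a lattice path with source `A` and sink `B`. -/
def IsLatticePath (A B : ℕ × ℕ) (p : List (ℕ × ℕ)) : Prop :=
  p.head? = some A ∧ p.getLast? = some B ∧ p.IsChain Step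

/-- The source of the `m`-th component of an `n`-path. -/
def source (m : Fin n) : ℕ × ℕ :=
  (n - 1 - (m : ℕ), (m : ℕ))

/-- The `m`-th terminal of `(λ, β)`. -/
def terminal (lam : Fin n → ℕ) (β : Fin n → Fin n) (m : Fin n) : ℕ × ℕ :=
  (lam m + (n - 1 - (m : ℕ)), (β m : ℕ))

/-- The disjoint `n`-paths whose `m`-th component runs from the `m`-th source to the `π m`-th
terminal. -/
def disjointPaths (lam : Fin n → ℕ) (β : Fin n → Fin n) (π : Equiv.Perm (Fin n)) :
    Set (Fin n → List (ℕ × ℕ)) :=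
  {Λ | (∀ m, IsLatticePath (source m) (terminal lam β (π m)) (Λ m)) ∧
    ∀ m m', m ≠ m' → (Λ m).Disjoint (Λ m')}

/-- The terminal pair `(λ, β)` is nonpermutable. -/
def Nonpermutable (lam : Fin n → ℕ) (β : Fin n → Fin n) : Prop :=
  ∀ π : Equiv.Perm (Fin n), π ≠ 1 → disjointPaths lam β π = ∅

/-! ### Efficiency -/

/-- A valid upper input: an upper tuple to which the Gessel–Viennot method applies. -/
def IsValidInput (lam : Fin n → ℕ) (β : Fin n → Fin n) : Prop :=
  IsUpper β ∧ Nonpermutable lam β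

/-- `η` is a gapless core tuple bounded by its platform, and its Gessel–Viennot determinant has
fewer monomials among its entries than that of any other such tuple whose determinant produces the
polynomial `s_λ(η; x)`. -/
def AttainsMaxEfficiency (lam : Fin n → ℕ) (η : Fin n → Fin n) : Prop :=
  (IsGaplessCore (dividers lam) η ∧ IsBoundedByPlatform (dividers lam) η) ∧
    ∀ η' : Fin n → Fin n,
      IsGaplessCore (dividers lam) η' → IsBoundedByPlatform (dividers lam) η' → η' ≠ η →
      (gvMatrix lam η').det = rowBoundSum lam η →
      monomialCount lam η < monomialCount lam η'

end

end GVInput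

namespace GVInput

open MvPolynomial

variable {n : ℕ}

/-! ### Complete homogeneous polynomials in an interval of variables -/

/-! Call a gapless core tuple gapless if it increases strictly on each carrel. The tuples attaining
maximum efficiency are exactly the gapless ones (`attainsMaxEfficiency_iff`), all of these are valid
inputs (`nonpermutable`), and their number is the parabolic Catalan number (`ncard_isGapless`).

Within a carrel, the critical indices are the strict right-to-left minima of the excess β_i - i. A
tuple bounded by its platform lies between its core, which increases on carrels, and its platform.
On this interval the row bound set is constant by column strictness (`rowBoundSet_eq_core`), and the
determinant is constant by column operations (`det_gvMatrix_eq_core`). The platform of a gapless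
core tuple is a flag, so the flagged Jacobi–Trudi formula (`det_gvMatrix_of_monotone`) makes the
determinant equal to the row bound sum on the whole interval. The monomial count increases strictly
with the tuple, so the core is the unique cheapest choice there. Distinct gapless tuples give
distinct polynomials (`IsGapless.eq_of_rowBoundSum_eq`): the polynomial determines the content of
the largest tableau, and the content determines that tableau because its columns are nested as sets.

These column sets, the key sets, also give the count. A chain of nested sets of sizes q, for q the
carrel ends, is the same as an R-permutation, and being the key of a gapless tuple translates into
avoidance of 312. -/

theorem multiset_map_X_prod (s : Multiset (Fin n)) :
    (s.map (X : Fin n → MvPolynomial (Fin n) ℤ)).prod = monomial (Multiset.toFinsupp s) 1 := by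
  induction s using Multiset.induction_on with
  | empty => simp
  | cons a s ih =>
    rw [Multiset.map_cons, Multiset.prod_cons, ih, ← Multiset.singleton_add, map_add,
      Multiset.toFinsupp_singleton, X, monomial_mul, one_mul]

/-- Multisets of variables from the interval correspond bijectively to exponents supported there, so
every coefficient is 0 or 1 and counting monomials means counting exponents. -/
theorem coeff_hPoly (u : ℤ) (i k : Fin n) (d : Fin n →₀ ℕ) :
    coeff d (hPoly u i k) =
      if (d.degree : ℤ) = u ∧ ∀ t ∈ d.support, i ≤ t ∧ t ≤ k then 1 else 0 := by
  unfold hPoly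
  by_cases hu : 0 ≤ u
  swap
  · rw [if_neg hu, if_neg, coeff_zero]
    rintro ⟨h, -⟩
    exact hu (h ▸ Int.natCast_nonneg _)
  obtain ⟨m, rfl⟩ := Int.eq_ofNat_of_zero_le hu
  rw [if_pos hu, hsymm, map_sum, coeff_sum]
  have hterm : ∀ s : Sym {t : Fin n // i ≤ t ∧ t ≤ k} (m : ℤ).toNat,
      coeff d (rename Subtype.val (s.1.map (X : _ → MvPolynomial _ ℤ)).prod) =
        if s.1.map Subtype.val = Finsupp.toMultiset d then 1 else 0 := by
    intro s
    rw [map_multiset_prod, Multiset.map_map]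
    have h2 : (Multiset.map (⇑(rename Subtype.val) ∘ X) s.1) =
        (s.1.map Subtype.val).map (X : Fin n → MvPolynomial (Fin n) ℤ) := by
      rw [Multiset.map_map]
      exact Multiset.map_congr rfl fun t _ => by simp
    rw [h2, multiset_map_X_prod, coeff_monomial]
    congr 1
    rw [Multiset.toFinsupp_eq_iff]
  rw [Finset.sum_congr rfl fun s _ => hterm s]
  by_cases hd : (d.degree : ℤ) = m ∧ ∀ t ∈ d.support, i ≤ t ∧ t ≤ k
  · rw [if_pos hd]
    have hmem : ∀ t ∈ Finsupp.toMultiset d, i ≤ t ∧ t ≤ k := fun t ht =>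
      hd.2 t (Finsupp.mem_toMultiset d t |>.1 ht)
    lift Finsupp.toMultiset d to Multiset {t : Fin n // i ≤ t ∧ t ≤ k} using hmem with s hs
    have hcard : s.card = (m : ℤ).toNat := by
      have h1 : s.card = (Finsupp.toMultiset d).card := by rw [← hs, Multiset.card_map]
      rw [h1, Finsupp.card_toMultiset]
      have := hd.1
      rw [Finsupp.degree_apply] at this
      simp only [Finsupp.sum, id]
      omega
    refine (Finset.sum_eq_single (⟨s, hcard⟩ : Sym _ _) ?_ ?_).trans (if_pos rfl)
    · intro t _ ht
      rw [if_neg]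
      intro h
      exact ht (Subtype.ext (Multiset.map_injective Subtype.val_injective h))
    · exact fun h => absurd (Finset.mem_univ (α := Sym _ _) _) h
  · rw [if_neg hd]
    refine Finset.sum_eq_zero fun s _ => if_neg fun h => hd ⟨?_, ?_⟩
    · have h1 := congrArg Multiset.card h
      rw [Multiset.card_map, s.2, Finsupp.card_toMultiset] at h1
      rw [Finsupp.degree_apply]
      simp only [Finsupp.sum, id] at h1
      omega
    · intro t ht
      rw [← Finsupp.mem_toMultiset, ← h, Multiset.mem_map] at ht
      obtain ⟨a, -, rfl⟩ := ht
      exact a.2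

/-- The monomials are split by whether they contain x_k. The exception is an empty interval in
degree 1: there h_{u-1} = 1 while both other terms vanish. -/
theorem hPoly_eq_add (u : ℤ) (i k k' : Fin n) (hk : (k' : ℕ) + 1 = k) (h : i ≤ k ∨ u ≠ 1) :
    hPoly u i k = hPoly u i k' + X k * hPoly (u - 1) i k := by
  ext d
  rw [coeff_add, coeff_X_mul', coeff_hPoly, coeff_hPoly, coeff_hPoly]
  by_cases hd : k ∈ d.support
  · have hne : d k ≠ 0 := Finsupp.mem_support_iff.1 hd
    have hle : Finsupp.single k 1 ≤ d := by
      rw [Finsupp.single_le_iff]; omega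
    obtain ⟨e, rfl⟩ := exists_add_of_le hle
    rw [if_pos hd, add_tsub_cancel_left]
    have hdeg : ((Finsupp.single k 1 + e).degree : ℤ) = 1 + e.degree := by
      rw [map_add, Finsupp.degree_single]; push_cast; rfl
    have hsup : ∀ t, t ∈ (Finsupp.single k 1 + e).support ↔ t = k ∨ t ∈ e.support := by
      intro t
      by_cases htk : t = k
      · subst htk; simp
      · simp [htk]
    rw [hdeg]
    simp only [hsup]
    have hz : ¬ (1 + (e.degree : ℤ) = u ∧ ∀ t, t = k ∨ t ∈ e.support → i ≤ t ∧ t ≤ k') := by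
      rintro ⟨-, h2⟩
      have := (h2 k (Or.inl rfl)).2
      rw [Fin.le_def] at this
      omega
    rw [if_neg hz, zero_add]
    congr 1
    apply propext
    constructor
    · rintro ⟨h1, h2⟩
      exact ⟨by omega, fun t ht => h2 t (Or.inr ht)⟩
    · rintro ⟨h1, h2⟩
      refine ⟨by omega, ?_⟩
      rintro t (rfl | ht)
      · refine ⟨?_, le_rfl⟩
        rcases h with h | h
        · exact h
        · have he : e ≠ 0 := by
            rintro rfl
            simp at h1
            omega
          obtain ⟨s, hs⟩ := Finsupp.support_nonempty_iff.2 he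
          exact (h2 s hs).1.trans (h2 s hs).2
      · exact h2 t ht
  · rw [if_neg hd, add_zero]
    congr 1
    apply propext
    refine and_congr_right fun _ => forall_congr' fun t => ?_
    refine imp_congr_right fun ht => and_congr_right fun _ => ?_
    have : t ≠ k := fun h => hd (h ▸ ht)
    rw [Fin.le_def, Fin.le_def]
    have : (t : ℕ) ≠ k := fun h => this (Fin.ext h)
    omega

theorem mem_support_hPoly {u : ℤ} {i k : Fin n} {d : Fin n →₀ ℕ} :
    d ∈ (hPoly u i k).support ↔ (d.degree : ℤ) = u ∧ ∀ t ∈ d.support, i ≤ t ∧ t ≤ k := by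
  rw [mem_support_iff, coeff_hPoly]
  split_ifs with h
  · exact iff_of_true one_ne_zero h
  · exact iff_of_false (fun h' => h' rfl) h

theorem hPoly_eq_zero {u : ℤ} {i k : Fin n} (hu : u ≠ 0) (hk : k < i) : hPoly u i k = 0 := by
  ext d
  rw [coeff_hPoly, coeff_zero, if_neg]
  rintro ⟨h1, h2⟩
  have hd : d ≠ 0 := by
    rintro rfl
    simp at h1
    omega
  obtain ⟨s, hs⟩ := Finsupp.support_nonempty_iff.2 hd
  exact absurd ((h2 s hs).1.trans (h2 s hs).2) (not_le.2 hk)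

theorem hPoly_self (m : ℕ) (i : Fin n) : hPoly (m : ℤ) i i = X i ^ m := by
  ext d
  rw [coeff_hPoly, X_pow_eq_monomial, coeff_monomial]
  congr 1
  apply propext
  constructor
  · rintro ⟨h1, h2⟩
    have hd : d = Finsupp.single i (d i) := by
      ext t
      by_cases ht : t = i
      · subst ht; simp
      · rw [Finsupp.single_eq_of_ne ht]
        by_contra hne
        have := h2 t (Finsupp.mem_support_iff.2 hne)
        exact ht (le_antisymm this.2 this.1)
    rw [hd, Finsupp.degree_single] at h1
    rw [hd]
    congr 1
    exact_mod_cast h1.symm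
  · rintro rfl
    refine ⟨by simp, fun t ht => ?_⟩
    have := Finsupp.support_single_subset ht
    rw [Finset.mem_singleton] at this
    subst this
    exact ⟨le_rfl, le_rfl⟩

theorem support_hPoly_subset {u : ℤ} {i k k' : Fin n} (h : k ≤ k') :
    (hPoly u i k).support ⊆ (hPoly u i k').support := by
  intro d hd
  rw [mem_support_hPoly] at hd ⊢
  exact ⟨hd.1, fun t ht => ⟨(hd.2 t ht).1, (hd.2 t ht).2.trans h⟩⟩

/-- A pure power of x_{k'} occurs only in the larger interval; in degree 0 both sides would be the
constant 1. -/
theorem card_support_hPoly_lt {u : ℤ} {i k k' : Fin n} (h : k < k') (hi : i ≤ k') (hu : 0 < u) :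
    (hPoly u i k).support.card < (hPoly u i k').support.card := by
  obtain ⟨m, rfl⟩ := Int.eq_ofNat_of_zero_le hu.le
  have hm : m ≠ 0 := by rintro rfl; simp at hu
  refine Finset.card_lt_card ⟨support_hPoly_subset h.le, fun hsub => ?_⟩
  have hsup : (Finsupp.single k' m).support = {k'} := by simp [hm]
  have h1 : Finsupp.single k' m ∈ (hPoly (m : ℤ) i k').support := by
    rw [mem_support_hPoly, hsup]
    refine ⟨by simp, fun t ht => ?_⟩
    rw [Finset.mem_singleton] at ht
    subst ht
    exact ⟨hi, le_rfl⟩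
  have h2 := (mem_support_hPoly.1 (hsub h1)).2 k' (by rw [hsup]; simp)
  exact absurd h2.2 (not_le.2 h)

theorem monomialCount_le {lam : Fin n → ℕ} {β β' : Fin n → Fin n} (h : ∀ i, β i ≤ β' i) :
    monomialCount lam β ≤ monomialCount lam β' :=
  Finset.sum_le_sum fun _ _ => Finset.sum_le_sum fun j _ =>
    Finset.card_le_card (support_hPoly_subset (h j))

/-- The number of monomials is strictly increasing in the upper tuple `β`. -/
theorem monomialCount_lt {lam : Fin n → ℕ} {β β' : Fin n → Fin n} (hβ : IsUpper β)
    (h : ∀ i, β i ≤ β' i) (hne : β' ≠ β) :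
    monomialCount lam β < monomialCount lam β' := by
  obtain ⟨j, hj⟩ := Function.ne_iff.1 hne
  have hlt : β j < β' j := lt_of_le_of_ne (h j) (Ne.symm hj)
  obtain ⟨i, hi, hu⟩ : ∃ i : Fin n, i ≤ β' j ∧ 0 < (lam j : ℤ) - (j : ℤ) + (i : ℤ) := by
    -- In row β'_j the degree is λ_j - j + β'_j, which is positive because j ≤ β_j < β'_j.
    refine ⟨β' j, le_rfl, ?_⟩
    have h1 := hβ j
    rw [Fin.le_def] at h1
    rw [Fin.lt_def] at hlt
    omega
  have hle : ∀ i j, (gvMatrix lam β i j).support.card ≤ (gvMatrix lam β' i j).support.card :=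
    fun i j => Finset.card_le_card (support_hPoly_subset (h j))
  refine Finset.sum_lt_sum (fun i _ => Finset.sum_le_sum fun j _ => hle i j)
    ⟨i, Finset.mem_univ _, ?_⟩
  exact Finset.sum_lt_sum (fun j _ => hle i j)
    ⟨j, Finset.mem_univ _, card_support_hPoly_lt hlt hi hu⟩

/-! ### Critical indices, platforms and cores -/

/-- The excess `β_i - i`. -/
def excess (β : Fin n → Fin n) (i : Fin n) : ℤ := (β i : ℤ) - (i : ℤ)

theorem SameCarrel.symm {R : Set ℕ} {i k : Fin n} (h : SameCarrel R i k) : SameCarrel R k i :=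
  fun q hq => (h q hq).symm

theorem SameCarrel.trans {R : Set ℕ} {i k l : Fin n} (h : SameCarrel R i k)
    (h' : SameCarrel R k l) : SameCarrel R i l :=
  fun q hq => (h q hq).trans (h' q hq)

theorem SameCarrel.of_le_of_le {R : Set ℕ} {i k l : Fin n} (h : SameCarrel R i l) (hik : i ≤ k)
    (hkl : k ≤ l) : SameCarrel R i k ∧ SameCarrel R k l := by
  rw [Fin.le_def] at hik hkl
  constructor <;> intro q hq <;> have := h q hq <;> constructor <;> intro <;> omega

theorem exists_carrelEnd (R : Set ℕ) (i : Fin n) :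
    ∃ x : Fin n, i ≤ x ∧ SameCarrel R i x ∧ IsCarrelEnd R x := by
  classical
  have hi := i.isLt
  have hex : ∃ q, (i : ℕ) < q ∧ (q ∈ R ∨ q = n) := ⟨n, hi, Or.inr rfl⟩
  obtain ⟨h1, h2⟩ := Nat.find_spec hex
  have hle : Nat.find hex ≤ n := Nat.find_min' hex ⟨hi, Or.inr rfl⟩
  refine ⟨⟨Nat.find hex - 1, by omega⟩, ?_, ?_, ?_⟩
  · rw [Fin.le_def]; dsimp only; omega
  · intro q hq
    dsimp only
    constructor
    · intro hlt
      have := Nat.find_min' hex ⟨hlt, Or.inl hq⟩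
      omega
    · intro; omega
  · unfold IsCarrelEnd
    dsimp only
    rwa [Nat.sub_add_cancel (by omega)]

theorem IsCarrelEnd.le_of_sameCarrel {R : Set ℕ} {x z : Fin n} (hx : IsCarrelEnd R x)
    (h : SameCarrel R x z) : z ≤ x := by
  rw [Fin.le_def]
  have := z.isLt
  rcases hx with hx | hx
  · have := h _ hx
    omega
  · omega

/-- The largest index to the left of `x` in its carrel with smaller excess is the next critical
index, and it is not to the left of `y`. -/
theorem IsCritical.of_next {R : Set ℕ} {β : Fin n → Fin n} {x y : Fin n} (hx : IsCritical R β x)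
    (hyx : SameCarrel R y x) (hlt : y < x) (he : excess β y < excess β x) :
    ∃ z, y ≤ z ∧ z < x ∧ IsCritical R β z := by
  classical
  set S := Finset.univ.filter fun z => y ≤ z ∧ z < x ∧ excess β z < excess β x with hS
  have hne : S.Nonempty := ⟨y, by simp [hS, hlt, he]⟩
  obtain ⟨-, h1, h2, h3⟩ := Finset.mem_filter.1 (S.max'_mem hne)
  refine ⟨_, h1, h2, IsCritical.next x _ hx (hyx.of_le_of_le h1 h2.le).2 h2 ?_ ?_⟩
  · unfold excess at h3; omega
  · intro z hz1 hz2 hz3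
    have : z ∈ S := by
      rw [hS, Finset.mem_filter]
      refine ⟨Finset.mem_univ _, h1.trans hz1.le, hz2, ?_⟩
      unfold excess
      omega
    exact absurd (S.le_max' z this) (not_le.2 hz1)

theorem IsCritical.excess_lt {R : Set ℕ} {β : Fin n → Fin n} {x : Fin n} (hx : IsCritical R β x) :
    ∀ z, x < z → SameCarrel R x z → excess β x < excess β z := by
  induction hx with
  | last x h =>
    intro z hz hs
    exact absurd (h.le_of_sameCarrel hs) (not_le.2 hz)
  | next x y hx hs hlt he hz ih =>
    intro z hyz hsz
    have hxy : excess β y < excess β x := by unfold excess; omega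
    rcases lt_trichotomy z x with h | h | h
    · have := hz z hyz h
      unfold excess at *
      omega
    · rwa [h]
    · exact hxy.trans (ih z h (hs.symm.trans hsz))

theorem nextCritical_mem (R : Set ℕ) (β : Fin n → Fin n) (i : Fin n) :
    i ≤ nextCritical R β i ∧ IsCritical R β (nextCritical R β i) := by
  classical
  have := Finset.min'_mem _ (critical_from_nonempty R β i)
  rw [Finset.mem_filter] at this
  exact this.2

theorem nextCritical_le {R : Set ℕ} {β : Fin n → Fin n} {i x : Fin n} (h : i ≤ x)
    (hx : IsCritical R β x) : nextCritical R β i ≤ x := by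
  classical
  exact Finset.min'_le _ _ (by rw [Finset.mem_filter]; exact ⟨Finset.mem_univ _, h, hx⟩)

theorem nextCritical_eq_self {R : Set ℕ} {β : Fin n → Fin n} {x : Fin n}
    (hx : IsCritical R β x) : nextCritical R β x = x :=
  le_antisymm (nextCritical_le le_rfl hx) (nextCritical_mem R β x).1

theorem sameCarrel_nextCritical (R : Set ℕ) (β : Fin n → Fin n) (i : Fin n) :
    SameCarrel R i (nextCritical R β i) := by
  obtain ⟨x, h1, h2, h3⟩ := exists_carrelEnd R i
  exact (h2.of_le_of_le (nextCritical_mem R β i).1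
    (nextCritical_le h1 (IsCritical.last x h3))).1

/-- To the right of a critical index the excess is larger; an index before it with smaller excess
would produce an earlier critical index. -/
theorem excess_nextCritical_le {R : Set ℕ} {β : Fin n → Fin n} {i z : Fin n} (hz : i ≤ z)
    (hs : SameCarrel R i z) : excess β (nextCritical R β i) ≤ excess β z := by
  have hi := nextCritical_mem R β i
  rcases lt_trichotomy (nextCritical R β i) z with h | h | h
  · exact (hi.2.excess_lt z h ((sameCarrel_nextCritical R β i).symm.trans hs)).le
  · rw [h]
  · by_contra hcon
    obtain ⟨y, h1, h2, h3⟩ := hi.2.of_next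
      (hs.symm.trans (sameCarrel_nextCritical R β i)) h (not_le.1 hcon)
    exact absurd (nextCritical_le (hz.trans h1) h3) (not_le.2 h2)

/-- This replaces the recursive definition by a closed form: strict right-to-left minima of the
excess. -/
theorem isCritical_iff {R : Set ℕ} {β : Fin n → Fin n} {x : Fin n} :
    IsCritical R β x ↔ ∀ z, x < z → SameCarrel R x z → excess β x < excess β z := by
  refine ⟨IsCritical.excess_lt, fun h => ?_⟩
  obtain ⟨h1, h2⟩ := nextCritical_mem R β x
  rcases h1.eq_or_lt with h3 | h3
  · exact h3 ▸ h2
  · exact absurd (h _ h3 (sameCarrel_nextCritical R β x))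
      (not_lt.2 (excess_nextCritical_le le_rfl fun _ _ => Iff.rfl))

/-- The entries increase strictly within each carrel. -/
def IsCarrelIncreasing (R : Set ℕ) (β : Fin n → Fin n) : Prop :=
  ∀ i k : Fin n, i < k → SameCarrel R i k → β i < β k

theorem platform_mono_of_sameCarrel {R : Set ℕ} {β : Fin n → Fin n} {i k : Fin n} (hik : i ≤ k)
    (hs : SameCarrel R i k) : platform R β i ≤ platform R β k := by
  unfold platform
  obtain ⟨h1, h2⟩ := nextCritical_mem R β i
  obtain ⟨h3, h4⟩ := nextCritical_mem R β k
  have hle : nextCritical R β i ≤ nextCritical R β k := nextCritical_le (hik.trans h3) h4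
  have he := excess_nextCritical_le (β := β) (hik.trans h3)
    (hs.trans (sameCarrel_nextCritical R β k))
  unfold excess at he
  rw [Fin.le_def] at hle ⊢
  omega

/-- Inside a carrel the excess at successive critical indices increases, hence so do the entries;
across a divider the inequality is the flag condition itself. -/
theorem IsGaplessCore.monotone_platform {R : Set ℕ} {β : Fin n → Fin n} (h : IsGaplessCore R β) :
    Monotone (platform R β) := by
  cases n with
  | zero => exact fun i => i.elim0
  | succ n =>
  rw [Fin.monotone_iff_le_succ]
  intro i
  by_cases hi : (i : ℕ) + 1 ∈ R
  · have hend : IsCarrelEnd R i.castSucc := Or.inl (by simpa using hi)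
    have := h.2 i.castSucc i.succ (by simpa using hi) (by simp)
    unfold platform
    rwa [nextCritical_eq_self (IsCritical.last _ hend)]
  · refine platform_mono_of_sameCarrel i.castSucc_lt_succ.le fun q hq => ?_
    have : q ≠ i + 1 := fun h => hi (h ▸ hq)
    simp only [Fin.val_castSucc, Fin.val_succ]
    omega

/-- The smallest tuple with the same critical entries as `β`: to the left of a critical entry its
entries decrease by one until the previous critical index. -/
noncomputable def core (R : Set ℕ) (β : Fin n → Fin n) (i : Fin n) : Fin n :=
  ⟨(platform R β i : ℕ) - ((nextCritical R β i : ℕ) - (i : ℕ)),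
    lt_of_le_of_lt (Nat.sub_le _ _) (platform R β i).isLt⟩

/-- The truncated subtraction in `core` is exact since critical entries are at least their indices.
Thus the excess of the core at `i` is the minimum of the excess of `β` from `i` to the end of the
carrel. -/
theorem excess_core {R : Set ℕ} {β : Fin n → Fin n} (hβ : IsUpper β) (i : Fin n) :
    excess (core R β) i = excess β (nextCritical R β i) := by
  have h1 := (nextCritical_mem R β i).1
  have h2 := hβ (nextCritical R β i)
  rw [Fin.le_def] at h1 h2
  unfold excess core platform
  dsimp only
  omega

theorem core_eq_of_isCritical {R : Set ℕ} {β : Fin n → Fin n} {i : Fin n}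
    (hi : IsCritical R β i) : core R β i = β i := by
  apply Fin.ext
  unfold core platform
  dsimp only
  rw [nextCritical_eq_self hi]
  omega

theorem isUpper_core {R : Set ℕ} {β : Fin n → Fin n} (hβ : IsUpper β) : IsUpper (core R β) := by
  intro i
  have h := excess_core (R := R) hβ i
  have h2 := hβ (nextCritical R β i)
  unfold excess at h
  rw [Fin.le_def] at h2 ⊢
  omega

theorem core_le {R : Set ℕ} {β : Fin n → Fin n} (hβ : IsUpper β) (i : Fin n) :
    core R β i ≤ β i := by
  have h := excess_core (R := R) hβ i
  have h2 := excess_nextCritical_le (R := R) (β := β) (i := i) le_rfl fun _ _ => Iff.rfl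
  unfold excess at h h2
  rw [Fin.le_def]
  omega

theorem core_le_platform (R : Set ℕ) (β : Fin n → Fin n) (i : Fin n) :
    core R β i ≤ platform R β i := by
  rw [Fin.le_def]
  exact Nat.sub_le _ _

theorem isCritical_core_iff {R : Set ℕ} {β : Fin n → Fin n} (hβ : IsUpper β) {x : Fin n} :
    IsCritical R (core R β) x ↔ IsCritical R β x := by
  constructor
  · intro h
    obtain ⟨h1, h2⟩ := nextCritical_mem R β x
    rcases h1.eq_or_lt with h3 | h3
    · exact h3 ▸ h2
    · have := h.excess_lt _ h3 (sameCarrel_nextCritical R β x)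
      rw [excess_core hβ, excess_core hβ, nextCritical_eq_self h2] at this
      exact absurd this (lt_irrefl _)
  · intro h
    rw [isCritical_iff]
    intro z hz hs
    rw [excess_core hβ, excess_core hβ, nextCritical_eq_self h]
    exact h.excess_lt _ (hz.trans_le (nextCritical_mem R β z).1)
      (hs.trans (sameCarrel_nextCritical R β z))

theorem nextCritical_core {R : Set ℕ} {β : Fin n → Fin n} (hβ : IsUpper β) :
    nextCritical R (core R β) = nextCritical R β := by
  funext i
  obtain ⟨h1, h2⟩ := nextCritical_mem R β i
  obtain ⟨h3, h4⟩ := nextCritical_mem R (core R β) i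
  exact le_antisymm (nextCritical_le h1 ((isCritical_core_iff hβ).2 h2))
    (nextCritical_le h3 ((isCritical_core_iff hβ).1 h4))

theorem platform_core {R : Set ℕ} {β : Fin n → Fin n} (hβ : IsUpper β) :
    platform R (core R β) = platform R β := by
  funext i
  unfold platform
  rw [nextCritical_core hβ, core_eq_of_isCritical (nextCritical_mem R β i).2]

theorem IsGaplessCore.core {R : Set ℕ} {β : Fin n → Fin n} (h : IsGaplessCore R β) :
    IsGaplessCore R (core R β) := by
  refine ⟨isUpper_core h.1, fun i j hi hj => ?_⟩
  rw [core_eq_of_isCritical (IsCritical.last i (Or.inl hi)), nextCritical_core h.1,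
    core_eq_of_isCritical (nextCritical_mem R β j).2]
  exact h.2 i j hi hj

theorem isBoundedByPlatform_core {R : Set ℕ} {β : Fin n → Fin n} (h : IsUpper β) :
    IsBoundedByPlatform R (core R β) := by
  refine ⟨isUpper_core h, fun i => ?_⟩
  rw [platform_core h]
  exact core_le_platform R β i

theorem isCarrelIncreasing_core {R : Set ℕ} {β : Fin n → Fin n} (h : IsUpper β) :
    IsCarrelIncreasing R (core R β) := by
  intro i k hik hs
  have h1 := excess_core (R := R) h i
  have h2 := excess_core (R := R) h k
  have h3 := excess_nextCritical_le (β := β) (hik.le.trans (nextCritical_mem R β k).1)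
    (hs.trans (sameCarrel_nextCritical R β k))
  unfold excess at h1 h2 h3
  rw [Fin.lt_def] at hik ⊢
  omega

/-- Integer entries that increase strictly gain at least 1 per step. -/
theorem IsCarrelIncreasing.excess_le {R : Set ℕ} {β : Fin n → Fin n}
    (h : IsCarrelIncreasing R β) {i k : Fin n} (hik : i ≤ k) (hs : SameCarrel R i k) :
    excess β i ≤ excess β k := by
  obtain ⟨m, hm⟩ : ∃ m, m = (k : ℕ) - i := ⟨_, rfl⟩
  induction m generalizing k with
  | zero =>
    have : i = k := Fin.ext (by rw [Fin.le_def] at hik; omega)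
    rw [this]
  | succ m ih =>
    have hlt : (i : ℕ) < k := by omega
    have hk := k.isLt
    set k' : Fin n := ⟨k - 1, by omega⟩ with hk'
    have hkv : (k' : ℕ) = k - 1 := rfl
    have hi1 : i ≤ k' := by rw [Fin.le_def]; omega
    have hk1 : k' < k := by rw [Fin.lt_def]; omega
    obtain ⟨hs1, hs2⟩ := hs.of_le_of_le hi1 hk1.le
    have h1 := ih hi1 hs1 (by omega)
    have h2 := h k' k hk1 hs2
    unfold excess at h1 ⊢
    rw [Fin.lt_def] at h2
    omega

theorem IsCarrelIncreasing.core_eq {R : Set ℕ} {β : Fin n → Fin n}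
    (h : IsCarrelIncreasing R β) (hβ : IsUpper β) : core R β = β := by
  funext i
  refine le_antisymm (core_le hβ i) ?_
  have h1 := excess_core (R := R) hβ i
  have h2 := h.excess_le (nextCritical_mem R β i).1 (sameCarrel_nextCritical R β i)
  unfold excess at h1 h2
  rw [Fin.le_def]
  omega

/-! ### The carrels of a shape -/

theorem lt_colLength_iff {lam : Fin n → ℕ} (hlam : Antitone lam) (i : Fin n) (j : ℕ) :
    (i : ℕ) < colLength lam j ↔ j < lam i := by
  unfold colLength
  constructor
  · intro h
    by_contra hcon
    have hsub : (Finset.univ.filter fun i => j < lam i) ⊆ Finset.Iio i := by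
      intro k hk
      rw [Finset.mem_filter] at hk
      rw [Finset.mem_Iio]
      by_contra hik
      exact hcon (hk.2.trans_le (hlam (not_lt.1 hik)))
    have := Finset.card_le_card hsub
    rw [Fin.card_Iio] at this
    omega
  · intro h
    have hsub : Finset.Iic i ⊆ (Finset.univ.filter fun i => j < lam i) := by
      intro k hk
      rw [Finset.mem_Iic] at hk
      rw [Finset.mem_filter]
      exact ⟨Finset.mem_univ _, h.trans_le (hlam hk)⟩
    have := Finset.card_le_card hsub
    rw [Fin.card_Iic] at this
    omega

theorem colLength_le (lam : Fin n → ℕ) (j : ℕ) : colLength lam j ≤ n :=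
  (Finset.card_le_univ _).trans (by simp)

/-- If row `i` is longer than row `k`, then the column with index `lam k` meets row `i` but not row
`k`, so its length is a divider between them. -/
theorem SameCarrel.lam_eq {lam : Fin n → ℕ} (hlam : Antitone lam) {i k : Fin n}
    (h : SameCarrel (dividers lam) i k) : lam i = lam k := by
  wlog hik : i ≤ k generalizing i k
  · exact (this h.symm (not_le.1 hik).le).symm
  by_contra hne
  have hlt : lam k < lam i := lt_of_le_of_ne (hlam hik) (Ne.symm hne)
  have h1 := (lt_colLength_iff hlam i (lam k)).2 hlt
  have h2 := (lt_colLength_iff hlam k (lam k)).not.2 (lt_irrefl _)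
  have hk := k.isLt
  have := h (colLength lam (lam k)) ⟨by omega, lam k, ⟨i, hlt⟩, rfl⟩
  omega

/-! ### Row bound sums of flags as determinants -/

/-- The column of the Gessel–Viennot matrix for a terminal with shifted row length `a` and
depth `k`. -/
noncomputable def gvCol (a : ℤ) (k : Fin n) : Fin n → MvPolynomial (Fin n) ℤ :=
  fun i => hPoly (a + (i : ℤ)) i k

/-- Positivity at `k` excludes the exceptional degree 1 in rows below `k`: there the degree is at
least 2. -/
theorem gvCol_eq_add {a : ℤ} {k k' : Fin n} (hk : (k' : ℕ) + 1 = k) (h : 0 < a + (k : ℤ)) :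
    gvCol a k = gvCol a k' + (X k : MvPolynomial (Fin n) ℤ) • gvCol (a - 1) k := by
  funext i
  rw [Pi.add_apply, Pi.smul_apply, smul_eq_mul]
  unfold gvCol
  rw [show a - 1 + (i : ℤ) = a + i - 1 by ring]
  apply hPoly_eq_add _ _ _ _ hk
  by_cases hi : i ≤ k
  · exact Or.inl hi
  · right
    rw [Fin.le_def] at hi
    omega

theorem gvMatrix_apply (lam : Fin n → ℕ) (β : Fin n → Fin n) (i j : Fin n) :
    gvMatrix lam β i j = gvCol ((lam j : ℤ) - (j : ℤ)) (β j) i := rfl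

theorem gvMatrix_update (lam : Fin n → ℕ) (β : Fin n → Fin n) (j : Fin n) (m : ℕ) (k : Fin n) :
    gvMatrix (Function.update lam j m) (Function.update β j k) =
      (gvMatrix lam β).updateCol j (gvCol ((m : ℤ) - (j : ℤ)) k) := by
  ext1 i l
  rw [gvMatrix_apply, Matrix.updateCol_apply]
  split_ifs with h
  · subst h; simp
  · rw [Function.update_of_ne h, Function.update_of_ne h, gvMatrix_apply]

theorem gvMatrix_update_right (lam : Fin n → ℕ) (β : Fin n → Fin n) (j k : Fin n) :
    gvMatrix lam (Function.update β j k) =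
      (gvMatrix lam β).updateCol j (gvCol ((lam j : ℤ) - (j : ℤ)) k) := by
  rw [← gvMatrix_update, Function.update_eq_self]

theorem det_gvMatrix_eq_add (lam : Fin n → ℕ) (β : Fin n → Fin n) (j k' : Fin n)
    (hk : (k' : ℕ) + 1 = β j) (hj : j < β j) :
    (gvMatrix lam β).det = (gvMatrix lam (Function.update β j k')).det +
      X (β j) * ((gvMatrix lam β).updateCol j (gvCol ((lam j : ℤ) - (j : ℤ) - 1) (β j))).det := by
  have h : gvMatrix lam β =
      (gvMatrix lam β).updateCol j (gvCol ((lam j : ℤ) - (j : ℤ)) (β j)) := by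
    rw [← gvMatrix_update_right, Function.update_eq_self]
  rw [gvMatrix_update_right, ← Matrix.det_updateCol_smul, ← Matrix.det_updateCol_add,
    ← gvCol_eq_add hk, ← h]
  rw [Fin.lt_def] at hj
  omega

theorem prod_castLE_of_eq {M : Type*} [CommMonoid M] {a b : ℕ} (h : a = b) (hle : a ≤ b)
    (f : Fin b → M) : ∏ j, f j = ∏ j : Fin a, f (Fin.castLE hle j) := by
  subst h
  rfl

theorem prod_castLE_of_succ_eq {M : Type*} [CommMonoid M] {a b : ℕ} (h : a + 1 = b) (hle : a ≤ b)
    (f : Fin b → M) : ∏ j, f j = f ⟨a, by omega⟩ * ∏ j : Fin a, f (Fin.castLE hle j) := by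
  subst h
  rw [Fin.prod_univ_castSucc, mul_comm]
  rfl

/-- Each box of row `j` has a box of row `l` below it with the same bound, so column strictness
already keeps row `j` below that bound. -/
theorem rowBoundSet_update_of_eq {lam : Fin n → ℕ} {β : Fin n → Fin n} {j l k' : Fin n}
    (hk : (k' : ℕ) + 1 = β j) (hjl : j < l) (hlam : lam j = lam l) (hβ : β j = β l) :
    rowBoundSet lam (Function.update β j k') = rowBoundSet lam β := by
  ext T
  refine and_congr_right fun hT => ⟨fun h i c => ?_, fun h i c => ?_⟩
  · have := h i c
    by_cases hi : i = j
    · subst hi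
      rw [Function.update_self] at this
      rw [Fin.le_def] at this ⊢
      omega
    · rwa [Function.update_of_ne hi] at this
  · by_cases hi : i = j
    · subst hi
      rw [Function.update_self]
      have hc : (c : ℕ) < lam l := hlam ▸ c.isLt
      have h1 := hT.2 i l c c.isLt hc hjl
      have h2 := (h l ⟨c, hc⟩)
      rw [Fin.lt_def] at h1
      rw [Fin.le_def] at h2 ⊢
      change (T i c : ℕ) < _ at h1
      rw [← hβ] at h2
      omega
    · rw [Function.update_of_ne hi]
      exact h i c

theorem rowBoundSum_congr {lam : Fin n → ℕ} {β β' : Fin n → Fin n}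
    (h : rowBoundSet lam β = rowBoundSet lam β') : rowBoundSum lam β = rowBoundSum lam β' := by
  unfold rowBoundSum
  rw [h]

/-- Removal of the last box of row `j`. -/
theorem rowBoundSum_eq_add {lam : Fin n → ℕ} {β : Fin n → Fin n} {j k' : Fin n} {m : ℕ}
    (hk : (k' : ℕ) + 1 = β j) (hm : m + 1 = lam j) (hlam : ∀ l, j < l → lam l ≤ m)
    (hβ : ∀ l, l < j → β l < β j) :
    rowBoundSum lam β = rowBoundSum lam (Function.update β j k') +
      X (β j) * rowBoundSum (Function.update lam j m) β := by
  classical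
  have hle : ∀ i, Function.update lam j m i ≤ lam i := by
    intro i
    by_cases hi : i = j
    · subst hi; rw [Function.update_self]; omega
    · rw [Function.update_of_ne hi]
  unfold rowBoundSum
  -- Either the last entry of row `j` stays below `β j`, or it equals `β j` and its box can be
  -- removed.
  rw [← Finset.sum_filter_add_sum_filter_not _ (fun T : Filling lam => T j ⟨m, by omega⟩ ≤ k')]
  congr 1
  · refine Finset.sum_congr ?_ fun _ _ => rfl
    ext T
    simp only [Finset.mem_filter, Finset.mem_univ, true_and]
    constructor
    · rintro ⟨⟨h1, h2⟩, h3⟩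
      refine ⟨h1, fun i c => ?_⟩
      by_cases hi : i = j
      · subst hi
        rw [Function.update_self]
        refine (h1.1 i ?_).trans h3
        rw [Fin.le_def]
        dsimp only
        omega
      · rw [Function.update_of_ne hi]; exact h2 i c
    · rintro ⟨h1, h2⟩
      refine ⟨⟨h1, fun i c => ?_⟩, ?_⟩
      · have := h2 i c
        by_cases hi : i = j
        · subst hi
          rw [Function.update_self] at this
          rw [Fin.le_def] at this ⊢
          omega
        · rwa [Function.update_of_ne hi] at this
      · have := h2 j ⟨m, by omega⟩
        rwa [Function.update_self] at this
  · rw [Finset.mul_sum]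
    have key : ∀ T : Filling lam, T ∈ rowBoundSet lam β → ¬ T j ⟨m, by omega⟩ ≤ k' →
        T j ⟨m, by omega⟩ = β j := by
      intro T hT h
      apply le_antisymm (hT.2 _ _)
      rw [Fin.le_def] at h ⊢
      omega
    -- The inverse map puts the box back with entry `β j`. Column strictness survives because rows
    -- above have smaller bounds and no box lies below.
    refine Finset.sum_bij' (fun T _ i c => T i (Fin.castLE (hle i) c))
      (fun T _ i c => if h : (c : ℕ) < Function.update lam j m i then T i ⟨c, h⟩ else β j)
      ?_ ?_ ?_ ?_ ?_
    · intro T hT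
      simp only [Finset.mem_filter, Finset.mem_univ, true_and] at hT ⊢
      obtain ⟨⟨⟨h1, h2⟩, h3⟩, h4⟩ := hT
      exact ⟨⟨fun i c c' hcc => h1 i (by simpa using hcc),
        fun i i' c hc hc' hii => h2 i i' c _ _ hii⟩, fun i c => h3 i _⟩
    · intro T hT
      simp only [Finset.mem_filter, Finset.mem_univ, true_and] at hT ⊢
      obtain ⟨⟨h1, h2⟩, h3⟩ := hT
      have hnot : ∀ i (c : Fin (lam i)), ¬ (c : ℕ) < Function.update lam j m i →
          i = j ∧ (c : ℕ) = m := by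
        intro i c h
        have hc := c.isLt
        by_cases hi : i = j
        · subst hi
          rw [Function.update_self] at h
          exact ⟨rfl, by omega⟩
        · rw [Function.update_of_ne hi] at h
          exact absurd hc h
      refine ⟨⟨⟨fun i c c' hcc => ?_, fun i i' c hc hc' hii => ?_⟩, fun i c => ?_⟩, ?_⟩
      · dsimp only
        rw [Fin.le_def] at hcc
        split_ifs with ha hb hb
        · exact h1 i (by rw [Fin.le_def]; exact hcc)
        · obtain ⟨rfl, -⟩ := hnot i c' hb
          exact h3 _ _
        · omega
        · exact le_rfl
      · dsimp only
        split_ifs with ha hb hb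
        · exact h2 i i' c _ _ hii
        · obtain ⟨rfl, -⟩ := hnot i' ⟨c, hc'⟩ hb
          exact (h3 _ _).trans_lt (hβ i hii)
        · obtain ⟨rfl, h5⟩ := hnot i ⟨c, hc⟩ ha
          have := hlam i' hii
          dsimp only at h5
          omega
        · have h5 := (hnot i ⟨c, hc⟩ ha).1
          have h6 := (hnot i' ⟨c, hc'⟩ hb).1
          exact absurd hii (by rw [h5, h6]; exact lt_irrefl _)
      · dsimp only
        split_ifs with ha
        · exact h3 _ _
        · obtain ⟨rfl, -⟩ := hnot i c ha
          exact le_rfl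
      · rw [dif_neg (by simp), Fin.le_def]
        omega
    · intro T hT
      simp only [Finset.mem_filter, Finset.mem_univ, true_and] at hT
      funext i c
      dsimp only
      split_ifs with ha
      · rfl
      · have hc := c.isLt
        by_cases hi : i = j
        · subst hi
          rw [Function.update_self] at ha
          rw [← key T hT.1 hT.2]
          congr 1
          exact Fin.ext (by dsimp only; omega)
        · rw [Function.update_of_ne hi] at ha
          exact absurd hc ha
    · intro T hT
      funext i c
      dsimp only
      rw [dif_pos (by simp)]
      rfl
    · intro T hT
      simp only [Finset.mem_filter, Finset.mem_univ, true_and] at hT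
      rw [← Finset.mul_prod_erase Finset.univ _ (Finset.mem_univ j),
        ← Finset.mul_prod_erase Finset.univ (fun i => ∏ c, X (T i (Fin.castLE (hle i) c)))
          (Finset.mem_univ j), ← mul_assoc]
      congr 1
      · have h1 : Function.update lam j m j + 1 = lam j := by rw [Function.update_self]; exact hm
        rw [prod_castLE_of_succ_eq h1 (hle j)]
        congr 2
        rw [← key T hT.1 hT.2]
        congr 1
        exact Fin.ext (by simp)
      · refine Finset.prod_congr rfl fun i hi => ?_
        exact prod_castLE_of_eq (Function.update_of_ne (Finset.ne_of_mem_erase hi) _ _) _ _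

/-- Entries of a column increase by at least the difference of the row indices. -/
theorem IsSemistandard.add_le {lam : Fin n → ℕ} (hlam : Antitone lam) {T : Filling lam}
    (hT : IsSemistandard lam T) {i i' : Fin n} (hii : i ≤ i') {c : ℕ} (hc : c < lam i)
    (hc' : c < lam i') : (T i ⟨c, hc⟩ : ℕ) + ((i' : ℕ) - i) ≤ T i' ⟨c, hc'⟩ := by
  obtain ⟨m, hm⟩ : ∃ m, m = (i' : ℕ) - i := ⟨_, rfl⟩
  induction m generalizing i' with
  | zero =>
    have : i = i' := Fin.ext (by rw [Fin.le_def] at hii; omega)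
    subst this
    omega
  | succ m ih =>
    have hi := i'.isLt
    set l : Fin n := ⟨i' - 1, by omega⟩ with hl
    have hlv : (l : ℕ) = i' - 1 := rfl
    have hli : l < i' := by rw [Fin.lt_def]; omega
    have hcl : c < lam l := hc'.trans_le (hlam hli.le)
    have h1 := ih (i' := l) (by rw [Fin.le_def]; omega) hcl (by omega)
    have h2 := hT.2 l i' c hcl hc' hli
    rw [Fin.lt_def] at h2
    omega

theorem IsSemistandard.le_apply {lam : Fin n → ℕ} (hlam : Antitone lam) {T : Filling lam}
    (hT : IsSemistandard lam T) (i : Fin n) (c : Fin (lam i)) : i ≤ T i c := by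
  have hi := i.isLt
  have h0 : (⟨0, by omega⟩ : Fin n) ≤ i := by rw [Fin.le_def]; exact Nat.zero_le _
  have := hT.add_le hlam h0 (c.isLt.trans_le (hlam h0)) c.isLt
  change _ + ((i : ℕ) - 0) ≤ (T i c : ℕ) at this
  rw [Fin.le_def]
  omega

theorem det_gvMatrix_id (lam : Fin n → ℕ) : (gvMatrix lam id).det = ∏ i, X i ^ lam i := by
  rw [Matrix.det_of_isUpperTriangular]
  · refine Finset.prod_congr rfl fun i _ => ?_
    rw [← hPoly_self]
    show hPoly ((lam i : ℤ) - i + i) i i = _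
    congr 1
    ring
  · intro i j hij
    refine hPoly_eq_zero ?_ hij
    have : j < i := hij
    rw [Fin.lt_def] at this
    omega

theorem rowBoundSum_id {lam : Fin n → ℕ} (hlam : Antitone lam) :
    rowBoundSum lam id = ∏ i, X i ^ lam i := by
  classical
  unfold rowBoundSum
  have : (Finset.univ.filter fun T : Filling lam => T ∈ rowBoundSet lam id) = {fun i _ => i} := by
    ext T
    simp only [Finset.mem_filter, Finset.mem_univ, true_and, Finset.mem_singleton]
    constructor
    · intro hT
      funext i c
      exact le_antisymm (hT.2 i c) (hT.1.le_apply hlam i c)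
    · rintro rfl
      exact ⟨⟨fun i _ _ _ => le_rfl, fun i i' _ _ _ h => h⟩, fun i _ => le_rfl⟩
  rw [this, Finset.sum_singleton]
  simp

/-- Let `a` be the last index with β_a > a. Then β_a = a + 1 = β_{a+1}, and `j` is the first index
with this value. Lowering β_j by one keeps the tuple monotone and upper, which drives the induction
for the flagged Jacobi–Trudi formula. -/
theorem exists_maximal_run {β : Fin n → Fin n} (hβ : Monotone β) (hup : IsUpper β)
    (hid : β ≠ id) : ∃ j l : Fin n, (j : ℕ) + 1 = l ∧ j < β j ∧ β j = β l ∧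
      ∀ i < j, β i < β j := by
  classical
  obtain ⟨j₀, hj₀⟩ := Function.ne_iff.1 hid
  have hne : (Finset.univ.filter fun j => j < β j).Nonempty :=
    ⟨j₀, by simpa using lt_of_le_of_ne (hup j₀) (Ne.symm hj₀)⟩
  obtain ⟨a, ha⟩ : ∃ a, a = Finset.max' _ hne := ⟨_, rfl⟩
  have ha1 : a < β a := by
    rw [ha]; exact (Finset.mem_filter.1 (Finset.max'_mem _ hne)).2
  have ha2 : ∀ z, z < β z → z ≤ a := fun z hz => by
    rw [ha]; exact Finset.le_max' _ _ (by simpa using hz)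
  have hav := ha1
  rw [Fin.lt_def] at hav
  have hlt := (β a).isLt
  set b : Fin n := ⟨a + 1, by omega⟩ with hb
  have hbv : (b : ℕ) = a + 1 := rfl
  have hab : a < b := by rw [Fin.lt_def]; omega
  have hbb : β b = b := by
    refine le_antisymm (not_lt.1 fun h => ?_) (hup b)
    exact absurd (ha2 b h) (not_le.2 hab)
  have hba : β a = b := by
    have := hβ hab.le
    rw [hbb] at this
    refine le_antisymm this ?_
    rw [Fin.le_def]
    omega
  have hne' : (Finset.univ.filter fun j => β j = b).Nonempty := ⟨a, by simpa using hba⟩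
  obtain ⟨j, hj⟩ : ∃ j, j = Finset.min' _ hne' := ⟨_, rfl⟩
  have hj1 : β j = b := by
    rw [hj]; exact (Finset.mem_filter.1 (Finset.min'_mem _ hne')).2
  have hj2 : ∀ z, β z = b → j ≤ z := fun z hz => by
    rw [hj]; exact Finset.min'_le _ _ (by simpa using hz)
  have hja := hj2 a hba
  have hjav := hja
  rw [Fin.le_def] at hjav
  refine ⟨j, ⟨j + 1, by omega⟩, rfl, ?_, ?_, fun i hi => ?_⟩
  · rw [hj1]; exact hja.trans_lt hab
  · apply le_antisymm
    · exact hβ (by rw [Fin.le_def]; exact Nat.le_succ _)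
    · rw [hj1, ← hbb]
      exact hβ (by rw [Fin.le_def]; dsimp only; omega)
  · refine lt_of_le_of_ne (hβ hi.le) fun h => ?_
    exact absurd (hj2 i (h.trans hj1)) (not_le.2 hi)

/-- The flagged Jacobi–Trudi formula. -/
theorem det_gvMatrix_of_monotone {lam : Fin n → ℕ} {β : Fin n → Fin n} (hlam : Antitone lam)
    (hβ : Monotone β) (hup : IsUpper β) : (gvMatrix lam β).det = rowBoundSum lam β := by
  classical
  -- Either the entry β_j drops by one or row `j` loses a box; both decrease this sum.
  obtain ⟨N, hN⟩ : ∃ N, N = ∑ i, lam i + ∑ i, (β i : ℕ) := ⟨_, rfl⟩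
  induction N using Nat.strong_induction_on generalizing lam β with
  | _ N ih =>
  by_cases hid : β = id
  · rw [hid, det_gvMatrix_id, rowBoundSum_id hlam]
  obtain ⟨j, l, hjl, hjβ, hβl, hprev⟩ := exists_maximal_run hβ hup hid
  have hjl' : j < l := by rw [Fin.lt_def]; omega
  have hjv := hjβ
  rw [Fin.lt_def] at hjv
  have hlt := (β j).isLt
  set k' : Fin n := ⟨β j - 1, by omega⟩ with hk'
  have hk : (k' : ℕ) + 1 = β j := by rw [hk']; dsimp only; omega
  have hle : ∀ i, Function.update β j k' i ≤ β i := by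
    intro i
    by_cases hi : i = j
    · subst hi; rw [Function.update_self, Fin.le_def]; omega
    · rw [Function.update_of_ne hi]
  have ih1 : (gvMatrix lam (Function.update β j k')).det =
      rowBoundSum lam (Function.update β j k') := by
    refine ih _ ?_ hlam ?_ ?_ rfl
    · rw [hN]
      refine Nat.add_lt_add_left (Finset.sum_lt_sum (fun i _ => hle i) ⟨j, Finset.mem_univ _, ?_⟩) _
      rw [Function.update_self]
      omega
    · intro a b hab
      by_cases hb : b = j
      · subst hb
        rcases hab.eq_or_lt with rfl | hab
        · exact le_rfl
        · rw [Function.update_self, Function.update_of_ne hab.ne]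
          have := hprev a hab
          rw [Fin.lt_def] at this
          rw [Fin.le_def]
          omega
      · rw [Function.update_of_ne hb]
        exact (hle a).trans (hβ hab)
    · intro i
      by_cases hi : i = j
      · subst hi
        rw [Function.update_self, Fin.le_def]
        omega
      · rw [Function.update_of_ne hi]
        exact hup i
  rw [det_gvMatrix_eq_add lam β j k' hk hjβ, ih1]
  -- For rows of equal length, lowering the degree of column `j` by one turns it into column `l`, so
  -- the second determinant vanishes; the tableaux likewise do not change when β_j drops. Otherwise
  -- row `j` has a removable box.
  by_cases hlamj : lam j = lam l
  · rw [rowBoundSum_congr (rowBoundSet_update_of_eq hk hjl' hlamj hβl)]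
    rw [Matrix.det_zero_of_column_eq hjl'.ne, mul_zero, add_zero]
    intro i
    rw [Matrix.updateCol_self, Matrix.updateCol_ne hjl'.ne', gvMatrix_apply, ← hβl, ← hlamj]
    congr 1
    omega
  · have hlt' : lam l < lam j := lt_of_le_of_ne (hlam hjl'.le) (Ne.symm hlamj)
    obtain ⟨m, hm⟩ : ∃ m, m + 1 = lam j := ⟨lam j - 1, by omega⟩
    have hnext : ∀ i, j < i → lam i ≤ m := by
      intro i hi
      have : lam i ≤ lam l := hlam (by rw [Fin.lt_def] at hi; rw [Fin.le_def]; omega)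
      omega
    rw [rowBoundSum_eq_add hk hm hnext hprev]
    congr 2
    rw [← hm]
    have h1 : ((m + 1 : ℕ) : ℤ) - (j : ℤ) - 1 = (m : ℤ) - j := by push_cast; ring
    rw [h1, ← gvMatrix_update, Function.update_eq_self]
    have hle' : ∀ i, Function.update lam j m i ≤ lam i := by
      intro i
      by_cases hi : i = j
      · subst hi; rw [Function.update_self]; omega
      · rw [Function.update_of_ne hi]
    refine ih _ ?_ ?_ hβ hup rfl
    · rw [hN]
      refine Nat.add_lt_add_right (Finset.sum_lt_sum (fun i _ => hle' i)
        ⟨j, Finset.mem_univ _, ?_⟩) _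
      rw [Function.update_self]
      omega
    · intro a b hab
      by_cases ha : a = j
      · subst ha
        rcases hab.eq_or_lt with rfl | hab
        · exact le_rfl
        · rw [Function.update_self, Function.update_of_ne hab.ne']
          exact hnext b hab
      · rw [Function.update_of_ne ha]
        exact (hle' b).trans (hlam hab)

/-! ### Tuples between a core and its platform -/

theorem nextCritical_of_le_of_le {R : Set ℕ} {β : Fin n → Fin n} {i l : Fin n} (hil : i ≤ l)
    (hl : l ≤ nextCritical R β i) : nextCritical R β l = nextCritical R β i :=
  le_antisymm (nextCritical_le hl (nextCritical_mem R β i).2)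
    (nextCritical_le (hil.trans (nextCritical_mem R β l).1) (nextCritical_mem R β l).2)

/-- Row `i` and the next critical row x have equal length. Column strictness forces T(i,c) + (x - i)
≤ T(x,c) ≤ β_x, which is the bound of the core. -/
theorem rowBoundSet_eq_core {lam : Fin n → ℕ} (hlam : Antitone lam) {β η : Fin n → Fin n}
    (h1 : ∀ i, core (dividers lam) β i ≤ η i) (h2 : ∀ i, η i ≤ platform (dividers lam) β i) :
    rowBoundSet lam η = rowBoundSet lam (core (dividers lam) β) := by
  ext T
  refine and_congr_right fun hT => ⟨fun h i c => ?_, fun h i c => (h i c).trans (h1 i)⟩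
  have hm := nextCritical_mem (dividers lam) β i
  set x := nextCritical (dividers lam) β i with hx
  have hc : (c : ℕ) < lam x := by
    rw [← (sameCarrel_nextCritical (dividers lam) β i).lam_eq hlam]
    exact c.isLt
  have h3 := hT.add_le hlam hm.1 c.isLt hc
  have h4 := (h x ⟨c, hc⟩).trans (h2 x)
  unfold platform at h4
  rw [nextCritical_eq_self hm.2, Fin.le_def] at h4
  change (T i c : ℕ) + _ ≤ _ at h3
  rw [Fin.le_def]
  unfold core platform
  dsimp only
  rw [← hx]
  omega

/-- If `M` has the columns of terminals on an antidiagonal, then replacing another column by that of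
a terminal below them makes the determinant vanish. -/
theorem det_updateCol_gvCol_eq_zero {M : Matrix (Fin n) (Fin n) (MvPolynomial (Fin n) ℤ)}
    {y b : Fin n} {a : ℤ} (hab : 0 ≤ a + (b : ℤ)) (d : ℕ) (k : Fin n)
    (hM : ∀ d' ≤ d, ∃ l ≠ y, ∃ k : Fin n, (k : ℕ) + d' = b ∧
      ∀ i, M i l = gvCol (a + (d' : ℤ)) k i)
    (hk : (b : ℕ) ≤ k + d) (hkb : k ≤ b) :
    (M.updateCol y (gvCol (a + (d : ℤ)) k)).det = 0 := by
  induction d generalizing k with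
  | zero =>
    obtain ⟨l, hl, k₀, hk₀, h⟩ := hM 0 le_rfl
    have : k = k₀ := Fin.ext (by rw [Fin.le_def] at hkb; omega)
    subst this
    refine Matrix.det_zero_of_column_eq (Ne.symm hl) fun i => ?_
    rw [Matrix.updateCol_self, Matrix.updateCol_ne hl, h]
  | succ d ihd =>
    obtain ⟨l, hl, k₀, hk₀, h⟩ := hM (d + 1) le_rfl
    obtain ⟨e, he⟩ : ∃ e, (k : ℕ) = k₀ + e := ⟨k - k₀, by omega⟩
    induction e generalizing k with
    | zero =>
      have : k = k₀ := Fin.ext (by omega)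
      subst this
      refine Matrix.det_zero_of_column_eq (Ne.symm hl) fun i => ?_
      rw [Matrix.updateCol_self, Matrix.updateCol_ne hl, h]
    | succ e ihe =>
      have hkn := k.isLt
      rw [Fin.le_def] at hkb
      set k' : Fin n := ⟨k - 1, by omega⟩ with hk'
      have hkv : (k' : ℕ) = k - 1 := rfl
      -- Peeling off x_k gives a column with the same `d + 1` and smaller depth, closer to the
      -- antidiagonal, and x_k times a column for `d` with the same depth. Both are covered by the
      -- double induction.
      rw [gvCol_eq_add (k' := k') (by omega) (by push_cast; omega), Matrix.det_updateCol_add,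
        Matrix.det_updateCol_smul, ihe k' (by omega) (by rw [Fin.le_def]; omega) (by omega)]
      rw [show a + ((d + 1 : ℕ) : ℤ) - 1 = a + (d : ℤ) by push_cast; ring,
        ihd k (fun d' hd' => hM d' (by omega)) (by omega) hkb, mul_zero, add_zero]

/-- Each unit of depth above `k₀` contributes x_k times a determinant that vanishes by
`det_updateCol_gvCol_eq_zero`. -/
theorem det_updateCol_gvCol_eq {M : Matrix (Fin n) (Fin n) (MvPolynomial (Fin n) ℤ)}
    {y b : Fin n} {a : ℤ} (hab : 0 ≤ a + (b : ℤ)) {d : ℕ} {k k₀ : Fin n}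
    (hM : ∀ d' < d, ∃ l ≠ y, ∃ k : Fin n, (k : ℕ) + d' = b ∧
      ∀ i, M i l = gvCol (a + (d' : ℤ)) k i)
    (hk₀ : (k₀ : ℕ) + d = b) (hk : k₀ ≤ k) (hkb : k ≤ b) :
    (M.updateCol y (gvCol (a + (d : ℤ)) k)).det =
      (M.updateCol y (gvCol (a + (d : ℤ)) k₀)).det := by
  rw [Fin.le_def] at hk
  obtain ⟨e, he⟩ : ∃ e, (k : ℕ) = k₀ + e := ⟨k - k₀, by omega⟩
  induction e generalizing k with
  | zero =>
    have : k = k₀ := Fin.ext (by omega)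
    rw [this]
  | succ e ih =>
    have hkn := k.isLt
    rw [Fin.le_def] at hkb
    set k' : Fin n := ⟨k - 1, by omega⟩ with hk'
    have hkv : (k' : ℕ) = k - 1 := rfl
    obtain ⟨d', rfl⟩ : ∃ d', d = d' + 1 := ⟨d - 1, by omega⟩
    rw [gvCol_eq_add (k' := k') (by omega) (by push_cast; omega), Matrix.det_updateCol_add,
      Matrix.det_updateCol_smul, ih (k := k') (by omega) (by rw [Fin.le_def]; omega) (by omega)]
    rw [show a + ((d' + 1 : ℕ) : ℤ) - 1 = a + (d' : ℤ) by push_cast; ring,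
      det_updateCol_gvCol_eq_zero hab d' k (fun d'' hd' => hM d'' (by omega)) (by omega) hkb,
      mul_zero, add_zero]

/-- The core entries are replaced by those of `η` one index at a time from left to right. When index
`y` is treated, the entries from `y + 1` to the next critical index are still those of the core, and
their terminals lie on an antidiagonal. -/
theorem det_gvMatrix_eq_core {lam : Fin n → ℕ} (hlam : Antitone lam) {β η : Fin n → Fin n}
    (hβ : IsUpper β)
    (h1 : ∀ i, core (dividers lam) β i ≤ η i) (h2 : ∀ i, η i ≤ platform (dividers lam) β i) :
    (gvMatrix lam η).det = (gvMatrix lam (core (dividers lam) β)).det := by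
  set γ := core (dividers lam) β with hγ
  suffices h : ∀ m ≤ n, (gvMatrix lam fun i => if (i : ℕ) < m then η i else γ i).det =
      (gvMatrix lam γ).det by
    have := h n le_rfl
    simpa using this
  intro m
  induction m with
  | zero => intro _; simp
  | succ m ih =>
    intro hm
    rw [← ih (by omega)]
    set θ : Fin n → Fin n := fun i => if (i : ℕ) < m then η i else γ i with hθ
    set y : Fin n := ⟨m, hm⟩ with hy
    have e1 : (fun i : Fin n => if (i : ℕ) < m + 1 then η i else γ i) =
        Function.update θ y (η y) := by
      funext i
      by_cases hi : i = y
      · rw [hi, Function.update_self, if_pos (Nat.lt_succ_self m)]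
      · rw [Function.update_of_ne hi, hθ]
        have : (i : ℕ) ≠ m := fun h => hi (Fin.ext h)
        dsimp only
        congr 1
        apply propext
        omega
    have e2 : θ = Function.update θ y (γ y) := by
      have : θ y = γ y := if_neg (lt_irrefl m)
      rw [← this, Function.update_eq_self]
    rw [e1, gvMatrix_update_right]
    conv_rhs => rw [e2, gvMatrix_update_right]
    obtain ⟨hyx, hx⟩ := nextCritical_mem (dividers lam) β y
    have hs := sameCarrel_nextCritical (dividers lam) β y
    have hnc : ∀ l, y ≤ l → l ≤ nextCritical (dividers lam) β y →
        (γ l : ℕ) + ((nextCritical (dividers lam) β y : ℕ) - l) =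
          β (nextCritical (dividers lam) β y) := by
      intro l hl1 hl2
      have h3 := excess_core (R := dividers lam) hβ l
      rw [nextCritical_of_le_of_le hl1 hl2, ← hγ] at h3
      unfold excess at h3
      rw [Fin.le_def] at hl2
      omega
    have hηy := h2 y
    unfold platform at hηy
    set x := nextCritical (dividers lam) β y with hxdef
    have hup := hβ x
    rw [Fin.le_def] at hyx hup
    have ha : (lam y : ℤ) - (y : ℤ) = ((lam x : ℤ) - x) + (((x : ℕ) - (y : ℕ) : ℕ) : ℤ) := by
      rw [hs.lam_eq hlam]
      push_cast [hyx]
      ring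
    rw [ha]
    refine det_updateCol_gvCol_eq (b := β x) (by omega) ?_ (hnc y le_rfl hyx) (h1 y) hηy
    intro d' hd'
    have hxn := x.isLt
    -- The core entry at x - d' is β_x - d', which supplies the antidiagonal column for d'.
    set l : Fin n := ⟨x - d', by omega⟩ with hl
    have hlv : (l : ℕ) = x - d' := rfl
    have hyl : y < l := by rw [Fin.lt_def]; omega
    have hlx : l ≤ x := by rw [Fin.le_def]; omega
    refine ⟨l, hyl.ne', γ l, ?_, fun i => ?_⟩
    · have := hnc l hyl.le hlx
      omega
    · have hθl : θ l = γ l := if_neg (by rw [Fin.lt_def] at hyl; exact not_lt.2 hyl.le)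
      rw [gvMatrix_apply, hθl, (hs.of_le_of_le hyl.le hlx).2.lam_eq hlam]
      congr 1
      omega

/-- Both sides agree with their values at the platform, which is a flag. -/
theorem det_gvMatrix_eq_rowBoundSum {lam : Fin n → ℕ} (hlam : Antitone lam) {β : Fin n → Fin n}
    (h : IsGaplessCore (dividers lam) β) (hb : IsBoundedByPlatform (dividers lam) β) :
    (gvMatrix lam β).det = rowBoundSum lam β := by
  have hp := core_le_platform (dividers lam) β
  have hpu : IsUpper (platform (dividers lam) β) := fun i => (h.1 i).trans (hb.2 i)
  rw [det_gvMatrix_eq_core hlam h.1 (core_le h.1) hb.2,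
    ← det_gvMatrix_eq_core hlam h.1 hp fun _ => le_rfl,
    det_gvMatrix_of_monotone hlam h.monotone_platform hpu]
  refine rowBoundSum_congr ?_
  rw [rowBoundSet_eq_core hlam hp fun _ => le_rfl, rowBoundSet_eq_core hlam (core_le h.1) hb.2]

theorem rowBoundSum_core {lam : Fin n → ℕ} (hlam : Antitone lam) {β : Fin n → Fin n}
    (hb : IsBoundedByPlatform (dividers lam) β) :
    rowBoundSum lam (core (dividers lam) β) = rowBoundSum lam β :=
  rowBoundSum_congr (rowBoundSet_eq_core hlam (core_le hb.1) hb.2).symm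

/-! ### Nonpermutability -/

/-- The lattice points of a path, indexed by time. -/
theorem IsLatticePath.exists_time {A B : ℕ × ℕ} {p : List (ℕ × ℕ)} (hp : IsLatticePath A B p) :
    ∃ f : ℕ → ℕ × ℕ, ∃ t, f 0 = A ∧ f t = B ∧ (∀ s ≤ t, f s ∈ p) ∧
      ∀ s < t, Step (f s) (f (s + 1)) := by
  obtain ⟨h1, h2, h3⟩ := hp
  have hne : p ≠ [] := by rintro rfl; simp at h1
  have hlen : 0 < p.length := List.length_pos_iff.2 hne
  refine ⟨fun s => p.getD s A, p.length - 1, ?_, ?_, ?_, ?_⟩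
  · rw [List.head?_eq_getElem?] at h1
    dsimp only
    rw [List.getD_eq_getElem?_getD, h1]
    rfl
  · rw [List.getLast?_eq_getElem?] at h2
    dsimp only
    rw [List.getD_eq_getElem?_getD, h2]
    rfl
  · intro s hs
    dsimp only
    rw [List.getD_eq_getElem _ _ (by omega)]
    exact List.getElem_mem _
  · intro s hs
    dsimp only
    rw [List.getD_eq_getElem _ _ (by omega), List.getD_eq_getElem _ _ (by omega)]
    exact List.isChain_iff_getElem.1 h3 s (by omega)

theorem step_bounds {f : ℕ → ℕ × ℕ} {t : ℕ} (h : ∀ s < t, Step (f s) (f (s + 1))) {s s' : ℕ}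
    (hs : s ≤ s') (hs' : s' ≤ t) :
    (f s).1 ≤ (f s').1 ∧ (f s).2 ≤ (f s').2 ∧ (f s').1 + (f s').2 = (f s).1 + (f s).2 + (s' - s) := by
  obtain ⟨e, rfl⟩ := Nat.exists_eq_add_of_le hs
  induction e with
  | zero => simp
  | succ e ih =>
    obtain ⟨h1, h2, h3⟩ := ih (by omega) (by omega)
    rcases h (s + e) (by omega) with h4 | h4 <;>
    · rw [← add_assoc, h4]
      dsimp only
      refine ⟨by omega, by omega, by omega⟩

/-- Disjoint paths from an antidiagonal keep their order. -/
theorem order_of_disjoint {f g : ℕ → ℕ × ℕ} {t : ℕ} (hf : ∀ s < t, Step (f s) (f (s + 1)))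
    (hg : ∀ s < t, Step (g s) (g (s + 1))) (hsum : (f 0).1 + (f 0).2 = (g 0).1 + (g 0).2)
    (h0 : (g 0).1 < (f 0).1) (hne : ∀ s ≤ t, f s ≠ g s) {s : ℕ} (hs : s ≤ t) :
    (g s).1 < (f s).1 := by
  induction s with
  | zero => exact h0
  | succ s ih =>
    have h1 := ih (by omega)
    have h2 := (step_bounds hf (Nat.zero_le _) hs).2.2
    have h3 := (step_bounds hg (Nat.zero_le _) hs).2.2
    have h4 : (g (s + 1)).1 ≤ (f (s + 1)).1 := by
      have h5 := (step_bounds hf (Nat.le_add_right s 1) hs).1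
      rcases hg s (by omega) with h | h <;> rw [h] <;> dsimp only <;> omega
    refine lt_of_le_of_ne h4 fun h => hne (s + 1) hs (Prod.ext h.symm (by omega))

theorem exists_inversion {π : Equiv.Perm (Fin n)} (h : π ≠ 1) :
    ∃ m m', m < m' ∧ π m' < π m := by
  by_contra! hcon
  apply h
  rw [← Equiv.Perm.monotone_iff]
  intro a b hab
  rcases hab.eq_or_lt with rfl | hlt
  · exact le_rfl
  · exact hcon a b hlt

/-- Let π m' < π m be an inversion with m < m', and let x be the next critical index from π m. When
the path to terminal x ends, the paths to the terminals π m, …, x and the path `m'` are all confined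
to x - π m + 1 points of one antidiagonal. They are one path too many. -/
theorem nonpermutable {lam : Fin n → ℕ} (hlam : Antitone lam) {β : Fin n → Fin n}
    (h : IsGaplessCore (dividers lam) β) (hb : IsBoundedByPlatform (dividers lam) β) :
    Nonpermutable lam β := by
  intro π hπ
  rw [Set.eq_empty_iff_forall_notMem]
  rintro Λ ⟨hΛ, hdisj⟩
  choose f t hf0 hft hmem hstep using fun m => (hΛ m).exists_time
  have hne : ∀ m m', m ≠ m' → ∀ s, s ≤ t m → s ≤ t m' → f m s ≠ f m' s :=
    fun m m' hmm s h1 h2 heq => hdisj m m' hmm (hmem m s h1) (heq ▸ hmem m' s h2)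
  have hsum : ∀ m s, s ≤ t m → (f m s).1 + (f m s).2 = n - 1 + s := by
    intro m s hs
    have := (step_bounds (hstep m) (Nat.zero_le s) hs).2.2
    rw [hf0, source] at this
    have := m.isLt
    omega
  have hX : ∀ m, ∀ s ≤ t m, (f m s).1 ≤ lam (π m) + (n - 1 - (π m : ℕ)) := by
    intro m s hs
    have := (step_bounds (hstep m) hs le_rfl).1
    rwa [hft] at this
  have hY : ∀ m, ∀ s ≤ t m, (f m s).2 ≤ β (π m) := by
    intro m s hs
    have := (step_bounds (hstep m) hs le_rfl).2.1
    rwa [hft] at this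
  have htime : ∀ m, lam (π m) + (n - 1 - (π m : ℕ)) + (β (π m) : ℕ) = n - 1 + t m := by
    intro m
    have := hsum m (t m) le_rfl
    rwa [hft] at this
  obtain ⟨m, m', hmm, hinv⟩ := exists_inversion hπ
  have horder : ∀ s ≤ t m, s ≤ t m' → (f m' s).1 < (f m s).1 := by
    intro s h1 h2
    refine order_of_disjoint (t := min (t m) (t m')) (fun s hs => hstep m s (by omega))
      (fun s hs => hstep m' s (by omega)) ?_ ?_
      (fun s hs => hne m m' hmm.ne s (by omega) (by omega)) (by omega)
    · rw [hsum m 0 (Nat.zero_le _), hsum m' 0 (Nat.zero_le _)]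
    · rw [hf0, hf0, source, source]
      have := m'.isLt
      rw [Fin.lt_def] at hmm
      dsimp only
      omega
  have hlamle := hlam hinv.le
  have hjn := (π m).isLt
  have hjn' := (π m').isLt
  have hinv' := hinv
  rw [Fin.lt_def] at hinv'
  -- If path `m'` stopped first, its terminal would lie to the right of everything path `m` reaches,
  -- against the order of the paths.
  have ht : t m ≤ t m' := by
    by_contra hcon
    have h1 := horder (t m') (by omega) le_rfl
    have h2 := hX m (t m') (by omega)
    rw [hft] at h1
    simp only [terminal] at h1
    omega
  set x := nextCritical (dividers lam) β (π m) with hx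
  obtain ⟨hjx, hxc⟩ := nextCritical_mem (dividers lam) β (π m)
  rw [← hx] at hjx hxc
  have hs := sameCarrel_nextCritical (dividers lam) β (π m)
  rw [← hx] at hs
  have hβx : ∀ l, l ≤ x → β l ≤ β x := by
    intro l hl
    have h1 := h.monotone_platform hl
    have h2 := hb.2 l
    unfold platform at h1 h2
    rw [nextCritical_eq_self hxc] at h1
    exact h2.trans h1
  have hxn := x.isLt
  have hjxv := hjx
  rw [Fin.le_def] at hjxv
  have hlamx := hs.lam_eq hlam
  have htx := htime (π.symm x)
  rw [Equiv.apply_symm_apply] at htx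
  set s := t (π.symm x) with hsdef
  -- The excess is minimal at x and the rows have equal length, so these paths are no shorter than
  -- the one to x.
  have htl : ∀ l, π m ≤ l → l ≤ x → s ≤ t (π.symm l) := by
    intro l hl1 hl2
    obtain ⟨c1, c2⟩ := hs.of_le_of_le hl1 hl2
    have h1 := htime (π.symm l)
    rw [Equiv.apply_symm_apply] at h1
    have h2 := excess_nextCritical_le (β := β) hl1 c1
    rw [← hx] at h2
    unfold excess at h2
    have h3 := c2.lam_eq hlam
    have := l.isLt
    omega
  have htm : s ≤ t m := by
    have := htl (π m) le_rfl hjx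
    rwa [Equiv.symm_apply_apply] at this
  have hxj : lam x + (n - 1 - (x : ℕ)) + ((x : ℕ) - π m) = lam (π m) + (n - 1 - (π m : ℕ)) := by
    omega
  -- Depths are at most β_x, which bounds first coordinates from below; terminal columns, and for
  -- path `m'` the order relative to path `m`, bound them from above.
  have hmaps : ∀ l ∈ insert (π m') (Finset.Icc (π m) x), (f (π.symm l) s).1 ∈
      Finset.Icc (lam x + (n - 1 - (x : ℕ))) (lam (π m) + (n - 1 - (π m : ℕ))) := by
    intro l hl
    rw [Finset.mem_insert, Finset.mem_Icc] at hl
    rw [Finset.mem_Icc]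
    have hlx : l ≤ x := by
      rcases hl with rfl | hl
      · exact hinv.le.trans hjx
      · exact hl.2
    have hst : s ≤ t (π.symm l) := by
      rcases hl with rfl | hl
      · rw [Equiv.symm_apply_apply]; exact htm.trans ht
      · exact htl l hl.1 hl.2
    have h1 := hsum _ s hst
    have h2 := hY _ s hst
    have h3 := hβx l hlx
    rw [Equiv.apply_symm_apply] at h2
    rw [Fin.le_def] at h3
    refine ⟨by omega, ?_⟩
    rcases hl with rfl | hl
    · rw [Equiv.symm_apply_apply]
      exact (horder s htm (htm.trans ht)).le.trans (hX m s htm)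
    · refine (hX _ s hst).trans ?_
      rw [Equiv.apply_symm_apply]
      have h4 := hlam hl.1
      have h5 := hl.1
      rw [Fin.le_def] at h5
      omega
  have hcard : (Finset.Icc (lam x + (n - 1 - (x : ℕ))) (lam (π m) + (n - 1 - (π m : ℕ)))).card <
      (insert (π m') (Finset.Icc (π m) x)).card := by
    rw [Finset.card_insert_of_notMem, Nat.card_Icc, Fin.card_Icc]
    · omega
    · rw [Finset.mem_Icc]
      exact fun hcon => absurd hcon.1 (not_le.2 hinv)
  obtain ⟨l, hl, l', hl', hll, heq⟩ := Finset.exists_ne_map_eq_of_card_lt_of_maps_to hcard hmaps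
  have hst : ∀ l ∈ insert (π m') (Finset.Icc (π m) x), s ≤ t (π.symm l) := by
    intro l hl
    rw [Finset.mem_insert, Finset.mem_Icc] at hl
    rcases hl with rfl | hl
    · rw [Equiv.symm_apply_apply]; exact htm.trans ht
    · exact htl l hl.1 hl.2
  have h1 := hsum _ s (hst l hl)
  have h2 := hsum _ s (hst l' hl')
  exact hne _ _ (fun h => hll (π.symm.injective h)) s (hst l hl) (hst l' hl')
    (Prod.ext heq (by omega))

/-! ### Strictly increasing enumerations -/

/-- `e` enumerates, strictly increasingly and by the indices `i < q`, the set `B`. -/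
def Enumerates (e : Fin n → ℕ) (q : ℕ) (B : Set ℕ) : Prop :=
  (∀ i k : Fin n, i < k → (k : ℕ) < q → e i < e k) ∧
    ∀ v, v ∈ B ↔ ∃ i : Fin n, (i : ℕ) < q ∧ e i = v

theorem Enumerates.mem {e : Fin n → ℕ} {q : ℕ} {B : Set ℕ} (h : Enumerates e q B) {i : Fin n}
    (hi : (i : ℕ) < q) : e i ∈ B :=
  (h.2 _).2 ⟨i, hi, rfl⟩

theorem Enumerates.add_le {e : Fin n → ℕ} {q : ℕ} {B : Set ℕ} (h : Enumerates e q B)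
    {i k : Fin n} (hik : i ≤ k) (hk : (k : ℕ) < q) : e i + k ≤ e k + i := by
  obtain ⟨m, hm⟩ : ∃ m, (k : ℕ) = i + m := ⟨k - i, by rw [Fin.le_def] at hik; omega⟩
  induction m generalizing k with
  | zero =>
    have : i = k := Fin.ext (by omega)
    rw [this]
  | succ m ih =>
    have hkn := k.isLt
    set l : Fin n := ⟨k - 1, by omega⟩ with hl
    have hlv : (l : ℕ) = k - 1 := rfl
    have h1 := ih (k := l) (by rw [Fin.le_def]; omega) (by omega) (by omega)
    have h2 := h.1 l k (by rw [Fin.lt_def]; omega) hk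
    omega

/-- The element of rank `i` in `B` is at most the term of index `i` of any increasing sequence in
`B`: by induction, the term g_a has rank at least `a`. -/
theorem Enumerates.le_of_mem {e g : Fin n → ℕ} {q : ℕ} {B : Set ℕ} (h : Enumerates e q B)
    {i : Fin n} (hg : ∀ a b : Fin n, a < b → b ≤ i → g a < g b) (hB : ∀ a ≤ i, g a ∈ B) :
    e i ≤ g i := by
  have key : ∀ m : ℕ, ∀ a : Fin n, (a : ℕ) = m → a ≤ i → ∀ k : Fin n, (k : ℕ) < q → e k = g a →
      a ≤ k := by
    intro m
    induction m with
    | zero =>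
      intro a ha _ k _ _
      rw [Fin.le_def]
      omega
    | succ m ih =>
      intro a ha hai k hk hek
      have han := a.isLt
      set c : Fin n := ⟨a - 1, by omega⟩ with hc
      have hcv : (c : ℕ) = a - 1 := rfl
      have hca : c < a := by rw [Fin.lt_def]; omega
      obtain ⟨l, hl, hel⟩ := (h.2 _).1 (hB c (hca.le.trans hai))
      have h1 := ih c (by omega) (hca.le.trans hai) l hl hel
      have h2 := hg c a hca hai
      have h3 : l < k := by
        by_contra hcon
        rcases (not_lt.1 hcon).eq_or_lt with h4 | h4
        · rw [h4] at hek; omega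
        · have := h.1 k l h4 hl
          omega
      rw [Fin.le_def] at h1 ⊢
      rw [Fin.lt_def] at h3
      omega
  obtain ⟨k, hk, hek⟩ := (h.2 _).1 (hB i le_rfl)
  have h1 := key i i rfl le_rfl k hk hek
  rw [← hek]
  rcases h1.eq_or_lt with h2 | h2
  · rw [h2]
  · exact (h.1 i k h2 hk).le

theorem Enumerates.eq {e g : Fin n → ℕ} {q : ℕ} {B : Set ℕ} (h : Enumerates e q B)
    (h' : Enumerates g q B) {i : Fin n} (hi : (i : ℕ) < q) : e i = g i := by
  have hlt : ∀ {b : Fin n}, b ≤ i → (b : ℕ) < q := fun hb => by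
    rw [Fin.le_def] at hb; omega
  exact le_antisymm
    (h.le_of_mem (fun a b hab hb => h'.1 a b hab (hlt hb)) fun a ha => h'.mem (hlt ha))
    (h'.le_of_mem (fun a b hab hb => h.1 a b hab (hlt hb)) fun a ha => h.mem (hlt ha))

theorem exists_enumerates (B : Finset (Fin n)) :
    ∃ e : Fin n → ℕ, Enumerates e B.card {v | ∃ h : v < n, (⟨v, h⟩ : Fin n) ∈ B} := by
  refine ⟨fun i => if h : (i : ℕ) < B.card then (B.orderEmbOfFin rfl ⟨i, h⟩ : ℕ) else 0, ?_, ?_⟩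
  · intro i k hik hk
    rw [Fin.lt_def] at hik
    dsimp only
    rw [dif_pos hk, dif_pos (hik.trans hk), ← Fin.lt_def, OrderEmbedding.lt_iff_lt, Fin.lt_def]
    exact hik
  · intro v
    constructor
    · rintro ⟨hv, hB⟩
      have : (⟨v, hv⟩ : Fin n) ∈ Set.range (B.orderEmbOfFin rfl) := by
        rw [Finset.range_orderEmbOfFin]; exact hB
      obtain ⟨k, hk⟩ := this
      have hkn : (k : ℕ) < n := k.isLt.trans_le ((Finset.card_le_univ B).trans (by simp))
      refine ⟨⟨k, hkn⟩, k.isLt, ?_⟩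
      dsimp only
      rw [dif_pos k.isLt]
      change ((B.orderEmbOfFin rfl) k : ℕ) = v
      rw [hk]
    · rintro ⟨i, hi, rfl⟩
      dsimp only
      rw [dif_pos hi]
      exact ⟨Fin.isLt _, Finset.orderEmbOfFin_mem B rfl _⟩

/-! ### The key of a tuple -/

/-- The entry in row `i` of a column of length `q` of the largest tableau with row bounds `β`,
namely the minimum of `β_k - (k - i)` over `i ≤ k < q`. -/
noncomputable def keyEntry (β : Fin n → Fin n) (q : ℕ) (i : Fin n) : ℕ :=
  sInf {v | ∃ k : Fin n, i ≤ k ∧ (k : ℕ) < q ∧ v + k = β k + i}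

/-- The set of entries of a column of length `q` of the largest tableau with row bounds `β`. -/
def keySet (β : Fin n → Fin n) (q : ℕ) : Set ℕ :=
  {v | ∃ i : Fin n, (i : ℕ) < q ∧ keyEntry β q i = v}

theorem keyEntry_add_le {β : Fin n → Fin n} (hβ : IsUpper β) {q : ℕ} {i k : Fin n} (hik : i ≤ k)
    (hk : (k : ℕ) < q) : keyEntry β q i + k ≤ β k + i := by
  have h := hβ k
  rw [Fin.le_def] at h
  have : keyEntry β q i ≤ β k + i - k := Nat.sInf_le ⟨k, hik, hk, by omega⟩
  omega

theorem exists_keyEntry {β : Fin n → Fin n} {q : ℕ} {i : Fin n}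
    (hi : (i : ℕ) < q) : ∃ k : Fin n, i ≤ k ∧ (k : ℕ) < q ∧ keyEntry β q i + k = β k + i :=
  Nat.sInf_mem (s := {v | ∃ k : Fin n, i ≤ k ∧ (k : ℕ) < q ∧ v + k = β k + i})
    ⟨β i, i, le_rfl, hi, rfl⟩

theorem keyEntry_le {β : Fin n → Fin n} (hβ : IsUpper β) {q : ℕ} {i : Fin n} (hi : (i : ℕ) < q) :
    keyEntry β q i ≤ β i := by
  have := keyEntry_add_le hβ le_rfl hi
  omega

theorem enumerates_keyEntry {β : Fin n → Fin n} (hβ : IsUpper β) (q : ℕ) :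
    Enumerates (keyEntry β q) q (keySet β q) := by
  refine ⟨fun i k hik hk => ?_, fun v => Iff.rfl⟩
  obtain ⟨l, hl1, hl2, hl3⟩ := exists_keyEntry (β := β) hk
  have h := keyEntry_add_le hβ (hik.le.trans hl1) hl2
  rw [Fin.lt_def] at hik
  omega

theorem keyEntry_antitone {β : Fin n → Fin n} (hβ : IsUpper β) {q q' : ℕ} (hq : q ≤ q')
    {i : Fin n} (hi : (i : ℕ) < q) : keyEntry β q' i ≤ keyEntry β q i := by
  obtain ⟨k, h1, h2, h3⟩ := exists_keyEntry (β := β) hi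
  have := keyEntry_add_le hβ h1 (h2.trans_le hq)
  omega

theorem lt_of_mem_keySet {β : Fin n → Fin n} (hβ : IsUpper β) {q v : ℕ} (hv : v ∈ keySet β q) :
    v < n := by
  obtain ⟨i, hi, rfl⟩ := hv
  exact (keyEntry_le hβ hi).trans_lt (β i).isLt

theorem keyEntry_full {β : Fin n → Fin n} (hβ : IsUpper β) (i : Fin n) : keyEntry β n i = i := by
  have hi := i.isLt
  set l : Fin n := ⟨n - 1, by omega⟩ with hl
  have hlv : (l : ℕ) = n - 1 := rfl
  have h1 := keyEntry_add_le hβ (i := i) (k := l) (by rw [Fin.le_def]; omega) l.isLt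
  have h2 := (β l).isLt
  obtain ⟨k, -, -, h3⟩ := exists_keyEntry (β := β) i.isLt
  have h4 := hβ k
  rw [Fin.le_def] at h4
  omega

theorem mem_keySet_full {β : Fin n → Fin n} (hβ : IsUpper β) {v : ℕ} :
    v ∈ keySet β n ↔ v < n :=
  ⟨lt_of_mem_keySet hβ, fun hv => ⟨⟨v, hv⟩, hv, keyEntry_full hβ _⟩⟩

/-- Below a gap of `keySet β q` there is a critical entry. -/
theorem exists_of_notMem_keySet {β : Fin n → Fin n} (hβ : IsUpper β) {q v : ℕ} {i : Fin n}
    (hi : (i : ℕ) < q) (hiv : keyEntry β q i < v) (hv : v ∉ keySet β q) :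
    ∃ x : Fin n, i ≤ x ∧ (x : ℕ) < q ∧ (β x : ℕ) < v ∧
      ∀ z : Fin n, x < z → (z : ℕ) < q → excess β x < excess β z := by
  classical
  have hne : (Finset.univ.filter fun z : Fin n => (z : ℕ) < q ∧ keyEntry β q z < v).Nonempty :=
    ⟨i, by simp [hi, hiv]⟩
  obtain ⟨x, hx⟩ : ∃ x, x = Finset.max' _ hne := ⟨_, rfl⟩
  have hx1 : (x : ℕ) < q ∧ keyEntry β q x < v := by
    rw [hx]; exact (Finset.mem_filter.1 (Finset.max'_mem _ hne)).2
  have hx2 : ∀ z : Fin n, (z : ℕ) < q → keyEntry β q z < v → z ≤ x := fun z h1 h2 => by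
    rw [hx]; exact Finset.le_max' _ _ (by simp [h1, h2])
  have hgt : ∀ z : Fin n, x < z → (z : ℕ) < q → v < keyEntry β q z := by
    intro z hz hzq
    refine lt_of_le_of_ne (not_lt.1 fun h => ?_) fun h => hv ⟨z, hzq, h.symm⟩
    exact absurd (hx2 z hzq h) (not_le.2 hz)
  -- The key entries jump over `v` after `x`. A minimum attained to the right of `x` would bound the
  -- next key entry by one more than that at `x`, so the minimum at `x` is attained at `x` itself.
  have hβx : (β x : ℕ) < v := by
    obtain ⟨k, hk1, hk2, hk3⟩ := exists_keyEntry (β := β) hx1.1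
    rcases hk1.eq_or_lt with rfl | hlt
    · omega
    · rw [Fin.lt_def] at hlt
      have hkn := k.isLt
      set l : Fin n := ⟨x + 1, by omega⟩ with hl
      have hlv : (l : ℕ) = x + 1 := rfl
      have h1 := hgt l (by rw [Fin.lt_def]; omega) (by omega)
      have h2 := keyEntry_add_le hβ (i := l) (k := k) (by rw [Fin.le_def]; omega) hk2
      omega
  refine ⟨x, hx2 i hi hiv, hx1.1, hβx, fun z hz hzq => ?_⟩
  rw [Fin.lt_def] at hz
  have hzn := z.isLt
  set l : Fin n := ⟨x + 1, by omega⟩ with hl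
  have hlv : (l : ℕ) = x + 1 := rfl
  have h1 := hgt l (by rw [Fin.lt_def]; omega) (by omega)
  have h2 := keyEntry_add_le hβ (i := l) (k := z) (by rw [Fin.le_def]; omega) hzq
  unfold excess
  omega

/-- `q` is the right end of a carrel. -/
def IsEnd (n : ℕ) (R : Set ℕ) (q : ℕ) : Prop :=
  q ∈ R ∨ q = n

theorem IsEnd.lt_iff {R : Set ℕ} {q : ℕ} (hq : IsEnd n R q) {i k : Fin n}
    (h : SameCarrel R i k) : (i : ℕ) < q ↔ (k : ℕ) < q := by
  rcases hq with hq | rfl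
  · exact h q hq
  · exact iff_of_true i.isLt k.isLt

theorem isCritical_of_excess_lt {R : Set ℕ} {β : Fin n → Fin n} {q : ℕ} (hq : IsEnd n R q)
    {x : Fin n} (hx : (x : ℕ) < q)
    (h : ∀ z : Fin n, x < z → (z : ℕ) < q → excess β x < excess β z) : IsCritical R β x :=
  isCritical_iff.2 fun z hz hs => h z hz ((hq.lt_iff hs).1 hx)

/-- A critical entry to the right of the divider `q` is at least as large as the entries to its
left. -/
theorem IsGaplessCore.keyEntry_le {R : Set ℕ} {β : Fin n → Fin n} (hβ : IsGaplessCore R β) {q : ℕ}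
    (hq : q ∈ R) {i x : Fin n} (hi : (i : ℕ) < q) (hx : q ≤ x) (hc : IsCritical R β x) :
    keyEntry β q i ≤ β x := by
  have hxn := x.isLt
  set l : Fin n := ⟨q - 1, by omega⟩ with hl
  have hlv : (l : ℕ) = q - 1 := rfl
  have hend : IsCarrelEnd R l := Or.inl (by rw [hlv, Nat.sub_add_cancel (by omega)]; exact hq)
  have h1 := hβ.monotone_platform (a := l) (b := x) (by rw [Fin.le_def]; omega)
  unfold platform at h1
  rw [nextCritical_eq_self hc, nextCritical_eq_self (IsCritical.last _ hend), Fin.le_def] at h1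
  have h2 := keyEntry_add_le hβ.1 (i := i) (k := l) (q := q) (by rw [Fin.le_def]; omega) (by omega)
  omega

/-- A value missing from the larger set would have a critical entry β_x below it. If x < q, this
contradicts that key entries increase and are bounded by β; if x ≥ q, it contradicts the flag
condition. -/
theorem IsGaplessCore.keySet_subset {R : Set ℕ} {β : Fin n → Fin n} (hβ : IsGaplessCore R β)
    {q q' : ℕ} (hq : IsEnd n R q) (hq' : IsEnd n R q') (hqq : q ≤ q') :
    keySet β q ⊆ keySet β q' := by
  rintro v ⟨i, hi, rfl⟩
  by_contra hv
  have hlt : keyEntry β q' i < keyEntry β q i :=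
    lt_of_le_of_ne (keyEntry_antitone hβ.1 hqq hi) fun h => hv ⟨i, by omega, h⟩
  obtain ⟨x, hx1, hx2, hx3, hx4⟩ := exists_of_notMem_keySet hβ.1 (hi.trans_le hqq) hlt hv
  by_cases hxq : (x : ℕ) < q
  · have h1 := (enumerates_keyEntry hβ.1 q).add_le hx1 hxq
    have h2 := GVInput.keyEntry_le hβ.1 hxq
    rw [Fin.le_def] at hx1
    omega
  · rcases hq with hq | rfl
    · have := hβ.keyEntry_le hq hi (not_lt.1 hxq) (isCritical_of_excess_lt hq' hx2 hx4)
      omega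
    · exact hxq x.isLt

theorem exists_isEnd (R : Set ℕ) (i : Fin n) :
    ∃ x : Fin n, i ≤ x ∧ SameCarrel R i x ∧ IsEnd n R (x + 1) :=
  exists_carrelEnd R i

/-- The excess is weakly increasing on the carrel, so the minimum is attained at `i`; hence the
tuple can be read off its key. -/
theorem IsCarrelIncreasing.keyEntry_eq {R : Set ℕ} {β : Fin n → Fin n}
    (h : IsCarrelIncreasing R β) (hβ : IsUpper β) {i x : Fin n} (hix : i ≤ x)
    (hs : SameCarrel R i x) : keyEntry β (x + 1) i = β i := by
  have hiv := hix
  rw [Fin.le_def] at hiv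
  refine le_antisymm (GVInput.keyEntry_le hβ (by omega)) ?_
  obtain ⟨k, h1, h2, h3⟩ := exists_keyEntry (β := β) (q := x + 1) (i := i) (by omega)
  have h4 := h.excess_le h1 (hs.of_le_of_le h1 (by rw [Fin.le_def]; omega)).1
  unfold excess at h4
  omega

theorem eq_of_keySet_eq {R : Set ℕ} {β β' : Fin n → Fin n} (h : IsCarrelIncreasing R β)
    (h' : IsCarrelIncreasing R β') (hβ : IsUpper β) (hβ' : IsUpper β')
    (hkey : ∀ q, IsEnd n R q → keySet β q = keySet β' q) : β = β' := by
  funext i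
  obtain ⟨x, h1, h2, h3⟩ := exists_isEnd R i
  apply Fin.ext
  rw [← h.keyEntry_eq hβ h1 h2, ← h'.keyEntry_eq hβ' h1 h2]
  have he := enumerates_keyEntry hβ (x + 1)
  rw [hkey _ h3] at he
  exact he.eq (enumerates_keyEntry hβ' _) (by rw [Fin.le_def] at h1; omega)

/-! ### Gapless tuples and 312-avoiding permutations -/

/-- Gapless tuples: the gapless core tuples that increase strictly within each carrel. -/
def IsGapless (R : Set ℕ) (β : Fin n → Fin n) : Prop :=
  IsGaplessCore R β ∧ IsCarrelIncreasing R β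

/-- The first `q` entries of `π` are the entries of the `q`-th key set of `β`, for each end `q` of
a carrel. -/
def IsKeyOf (R : Set ℕ) (π : Equiv.Perm (Fin n)) (β : Fin n → Fin n) : Prop :=
  ∀ q, IsEnd n R q → ∀ i, (π i : ℕ) ∈ keySet β q ↔ (i : ℕ) < q

theorem IsKeyOf.right_unique {R : Set ℕ} {π : Equiv.Perm (Fin n)} {β β' : Fin n → Fin n}
    (hβ : IsGapless R β) (hβ' : IsGapless R β') (h : IsKeyOf R π β) (h' : IsKeyOf R π β') :
    β = β' := by
  refine eq_of_keySet_eq hβ.2 hβ'.2 hβ.1.1 hβ'.1.1 fun q hq => ?_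
  ext v
  by_cases hv : v < n
  · have h1 := h q hq (π.symm ⟨v, hv⟩)
    have h2 := h' q hq (π.symm ⟨v, hv⟩)
    rw [Equiv.apply_symm_apply] at h1 h2
    exact h1.trans h2.symm
  · exact iff_of_false (fun hm => hv (lt_of_mem_keySet hβ.1.1 hm))
      (fun hm => hv (lt_of_mem_keySet hβ'.1.1 hm))

/-- The smallest end of a carrel whose key set contains `v`. -/
noncomputable def level (R : Set ℕ) (β : Fin n → Fin n) (v : Fin n) : ℕ :=
  sInf {q | IsEnd n R q ∧ (v : ℕ) ∈ keySet β q}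

theorem level_mem (R : Set ℕ) {β : Fin n → Fin n} (hβ : IsUpper β) (v : Fin n) :
    IsEnd n R (level R β v) ∧ (v : ℕ) ∈ keySet β (level R β v) :=
  Nat.sInf_mem (s := {q | IsEnd n R q ∧ (v : ℕ) ∈ keySet β q})
    ⟨n, Or.inr rfl, (mem_keySet_full hβ).2 v.isLt⟩

theorem IsGaplessCore.level_le_iff {R : Set ℕ} {β : Fin n → Fin n} (hβ : IsGaplessCore R β)
    {q : ℕ} (hq : IsEnd n R q) (v : Fin n) : level R β v ≤ q ↔ (v : ℕ) ∈ keySet β q := by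
  obtain ⟨h1, h2⟩ := level_mem R hβ.1 v
  exact ⟨fun h => hβ.keySet_subset h1 hq h h2, fun h => Nat.sInf_le ⟨hq, h⟩⟩

theorem IsKeyOf.level_apply_le_iff {R : Set ℕ} {β : Fin n → Fin n} (hβ : IsGaplessCore R β)
    {π : Equiv.Perm (Fin n)} (h : IsKeyOf R π β) {q : ℕ} (hq : IsEnd n R q) (i : Fin n) :
    level R β (π i) ≤ q ↔ (i : ℕ) < q :=
  (hβ.level_le_iff hq _).trans (h q hq i)

/-- The order in which the values appear in the permutation with a given key. -/
noncomputable def rankKey (R : Set ℕ) (β : Fin n → Fin n) (v : Fin n) : ℕ ×ₗ Fin n :=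
  toLex (level R β v, v)

theorem rankKey_injective (R : Set ℕ) (β : Fin n → Fin n) : Function.Injective (rankKey R β) := by
  intro v w h
  have := congrArg (fun p => (ofLex p).2) h
  exact this

/-- The key fixes which values lie in each carrel and the permutation sorts each carrel, so it lists
the values by level and then by size. This determines it uniquely. -/
theorem IsKeyOf.monotone_rankKey {R : Set ℕ} {β : Fin n → Fin n} (hβ : IsGaplessCore R β)
    {π : Equiv.Perm (Fin n)} (h : IsKeyOf R π β) (hπ : IsRPermutation R π) :
    Monotone (rankKey R β ∘ π) := by
  intro i k hik
  rcases hik.eq_or_lt with rfl | hik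
  · exact le_rfl
  have hle := fun {q} (hq : IsEnd n R q) (i : Fin n) => h.level_apply_le_iff hβ hq i
  have hikv := hik
  rw [Fin.lt_def] at hikv
  change toLex _ ≤ toLex _
  rw [Prod.Lex.toLex_le_toLex]
  by_cases hs : SameCarrel R i k
  · right
    refine ⟨?_, (hπ i k hik hs).le⟩
    have hi := (level_mem R hβ.1 (π i)).1
    have hk := (level_mem R hβ.1 (π k)).1
    exact le_antisymm ((hle hk i).2 ((hk.lt_iff hs).2 ((hle hk k).1 le_rfl)))
      ((hle hi k).2 ((hi.lt_iff hs).1 ((hle hi i).1 le_rfl)))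
  · left
    unfold SameCarrel at hs
    push Not at hs
    obtain ⟨q, hq, hs⟩ := hs
    have h1 : (i : ℕ) < q ∧ ¬ (k : ℕ) < q := by omega
    have h2 := (hle (Or.inl hq) i).2 h1.1
    have h3 := mt (hle (Or.inl hq) k).1 h1.2
    dsimp only
    omega

theorem IsKeyOf.left_unique {R : Set ℕ} {β : Fin n → Fin n} (hβ : IsGaplessCore R β)
    {π π' : Equiv.Perm (Fin n)} (h : IsKeyOf R π β) (h' : IsKeyOf R π' β)
    (hπ : IsRPermutation R π) (hπ' : IsRPermutation R π') : π = π' := by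
  have := Tuple.unique_monotone (h.monotone_rankKey hβ hπ) (h'.monotone_rankKey hβ hπ')
  ext1 i
  exact rankKey_injective R β (congrFun this i)

theorem card_keySet {β : Fin n → Fin n} (hβ : IsUpper β) {q : ℕ} (hq : q ≤ n)
    [DecidablePred fun v : Fin n => (v : ℕ) ∈ keySet β q] :
    (Finset.univ.filter fun v : Fin n => (v : ℕ) ∈ keySet β q).card = q := by
  have he := enumerates_keyEntry hβ q
  have hcard : (Finset.univ.filter fun i : Fin n => (i : ℕ) < q).card = q := by
    rw [Fin.card_filter_val_lt, min_eq_right hq]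
  refine Eq.trans (Eq.symm ?_) hcard
  refine Finset.card_bij (fun i hi => ⟨keyEntry β q i, ?_⟩) ?_ ?_ ?_
  · exact (keyEntry_le hβ (Finset.mem_filter.1 hi).2).trans_lt (β i).isLt
  · intro i hi
    rw [Finset.mem_filter] at hi ⊢
    exact ⟨Finset.mem_univ _, i, hi.2, rfl⟩
  · intro i hi k hk hik
    rw [Finset.mem_filter] at hi hk
    rw [Fin.mk.injEq] at hik
    rcases lt_trichotomy i k with h | h | h
    · exact absurd hik (he.1 i k h hk.2).ne
    · exact h
    · exact absurd hik (he.1 k i h hi.2).ne'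
  · intro v hv
    rw [Finset.mem_filter] at hv
    obtain ⟨-, i, hi, h⟩ := hv
    exact ⟨i, by simpa using hi, Fin.ext h⟩

/-- Sorting the values by `rankKey` works because the key sets are nested and the set for `q` has
`q` elements. -/
theorem IsGaplessCore.exists_isKeyOf {R : Set ℕ} (hR : ∀ q ∈ R, q < n) {β : Fin n → Fin n}
    (hβ : IsGaplessCore R β) : ∃ π, IsRPermutation R π ∧ IsKeyOf R π β := by
  classical
  set π := Tuple.sort (rankKey R β) with hπ
  have hmono : Monotone (rankKey R β ∘ π) := Tuple.monotone_sort _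
  have hlev : Monotone fun i => level R β (π i) := by
    intro i k hik
    have h1 : toLex _ ≤ toLex _ := hmono hik
    rw [Prod.Lex.toLex_le_toLex] at h1
    rcases h1 with h1 | h1
    · exact h1.le
    · exact h1.1.le
  have hkey : IsKeyOf R π β := by
    intro q hq i
    have hqn : q ≤ n := by
      rcases hq with hq | rfl
      · exact (hR q hq).le
      · exact le_rfl
    have h1 := Tuple.lt_card_le_iff_apply_le_of_monotone (a := q) (j := i) hlev
    have h2 : (Finset.univ.filter fun i => level R β (π i) ≤ q).card =
        (Finset.univ.filter fun v : Fin n => (v : ℕ) ∈ keySet β q).card :=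
      Finset.card_equiv π fun i => by simp [hβ.level_le_iff hq]
    rw [h2, card_keySet hβ.1 hqn, hβ.level_le_iff hq] at h1
    exact h1.symm
  refine ⟨π, fun i k hik hs => ?_, hkey⟩
  have h1 : toLex _ ≤ toLex _ := hmono hik.le
  rw [Prod.Lex.toLex_le_toLex] at h1
  rcases h1 with h1 | h1
  · exfalso
    have hi := (level_mem R hβ.1 (π i)).1
    have h2 := (hkey.level_apply_le_iff hβ hi i).1 le_rfl
    have h3 := (hkey.level_apply_le_iff hβ hi k).2 ((hi.lt_iff hs).1 h2)
    dsimp only at h1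
    omega
  · exact lt_of_le_of_ne h1.2 fun h => hik.ne (π.injective h)

/-- The value π c is a gap of the key set for q' above π b, so some critical entry β_x lies below
it. If x ≥ q, the flag condition gives π a ≤ β_x < π c. If x < q, the minimum defining π b is
attained before `q`, so π b would already belong to the key set for `q`. -/
theorem IsKeyOf.not_contains312 {R : Set ℕ} {β : Fin n → Fin n} (hβ : IsGaplessCore R β)
    {π : Equiv.Perm (Fin n)} (h : IsKeyOf R π β) : ¬ Contains312 R π := by
  rintro ⟨q, hq, q', hq', a, b, c, ha, hqb, hb, hc, hbc, hca⟩
  have ha' := (h q (Or.inl hq) a).2 ha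
  have hb' := (h q' (Or.inl hq') b).2 hb
  have hbq := mt (h q (Or.inl hq) b).1 (not_lt.2 hqb)
  have hcq := mt (h q' (Or.inl hq') c).1 (not_lt.2 hc)
  rw [Fin.lt_def] at hbc hca
  obtain ⟨i, hi, hib⟩ := hb'
  obtain ⟨l, hl, hla⟩ := ha'
  obtain ⟨x, hx1, hx2, hx3, hx4⟩ := exists_of_notMem_keySet hβ.1 hi (hib ▸ hbc) hcq
  by_cases hxq : (x : ℕ) < q
  · rw [Fin.le_def] at hx1
    have hiq : (i : ℕ) < q := by omega
    apply hbq
    refine ⟨i, hiq, ?_⟩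
    rw [← hib]
    refine le_antisymm ?_ (keyEntry_antitone hβ.1 (by omega) hiq)
    obtain ⟨k, hk1, hk2, hk3⟩ := exists_keyEntry (β := β) hi
    by_cases hkq : (k : ℕ) < q
    · have := keyEntry_add_le hβ.1 hk1 hkq
      omega
    · have h5 := hx4 k (by rw [Fin.lt_def]; omega) hk2
      have h6 := keyEntry_add_le hβ.1 (i := i) (k := x) hx1 hxq
      unfold excess at h5
      omega
  · have := hβ.keyEntry_le hq hl (not_lt.1 hxq) (isCritical_of_excess_lt (Or.inl hq') hx2 hx4)
    omega

/-- With q the end of the carrel of `i`, β_i is taken to be the element of rank `i` among the first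
q values of `π`. Avoidance of 312 yields both the flag condition and the identification of all key
sets with the sets of initial values. -/
theorem exists_gapless_of_not_contains312 {R : Set ℕ} (hR : ∀ q ∈ R, q < n)
    {π : Equiv.Perm (Fin n)} (h312 : ¬ Contains312 R π) :
    ∃ β : Fin n → Fin n, IsGapless R β ∧ IsKeyOf R π β := by
  classical
  have hRn : ∀ {q}, IsEnd n R q → q ≤ n := by
    rintro q (hq | rfl)
    · exact (hR q hq).le
    · exact le_rfl
  -- `B q` is the set of the first `q` entries of `π`, enumerated by `e q`
  set B : ℕ → Set ℕ := fun q => {v | ∃ h : v < n, (π.symm ⟨v, h⟩ : ℕ) < q} with hB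
  have hmemB : ∀ q v, v ∈ B q ↔ ∃ h : v < n, (π.symm ⟨v, h⟩ : ℕ) < q := fun q v => Iff.rfl
  have hBmono : ∀ {q q'}, q ≤ q' → B q ⊆ B q' := fun hqq v ⟨h1, h2⟩ => ⟨h1, h2.trans_le hqq⟩
  have hex : ∀ q, ∃ e : Fin n → ℕ, q ≤ n → Enumerates e q (B q) := by
    intro q
    obtain ⟨e, he⟩ := exists_enumerates (Finset.univ.filter fun v => (π.symm v : ℕ) < q)
    refine ⟨e, fun hq => ?_⟩
    have hcard : (Finset.univ.filter fun v => (π.symm v : ℕ) < q).card = q := by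
      have h1 : (Finset.univ.filter fun v => (π.symm v : ℕ) < q).card =
          (Finset.univ.filter fun i : Fin n => (i : ℕ) < q).card :=
        Finset.card_equiv π.symm fun i => by simp
      rw [h1, Fin.card_filter_val_lt, min_eq_right hq]
    rw [hcard] at he
    convert he using 1
    ext v
    simp [hB]
  choose e he using hex
  -- Here `x i` is the last index of the carrel of `i`, so `x i + 1` is the end in the unshifted
  -- convention for dividers.
  choose x hix hsx hxend using exists_isEnd (n := n) R
  -- an element of `B q'` that is not in `B q`, below a gap of `B q'`
  have havoid : ∀ {q q'}, IsEnd n R q → IsEnd n R q' → q ≤ q' → ∀ {a b c}, a ∈ B q → b ∈ B q' →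
      b ∉ B q → c ∉ B q' → b < c → c < a → False := by
    intro q q' hq hq' hqq a b c ha hb hbq hc hbc hca
    obtain ⟨han, ha⟩ := ha
    obtain ⟨hbn, hb⟩ := hb
    have hcn : c < n := hca.trans han
    have hc' : q' ≤ (π.symm ⟨c, hcn⟩ : ℕ) := not_lt.1 fun h => hc ⟨hcn, h⟩
    have hb' : q ≤ (π.symm ⟨b, hbn⟩ : ℕ) := not_lt.1 fun h => hbq ⟨hbn, h⟩
    have hqR : q ∈ R := hq.resolve_right (by have := (π.symm ⟨b, hbn⟩).isLt; omega)
    have hqR' : q' ∈ R := hq'.resolve_right (by have := (π.symm ⟨c, hcn⟩).isLt; omega)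
    refine h312 ⟨q, hqR, q', hqR', π.symm ⟨a, han⟩, π.symm ⟨b, hbn⟩, π.symm ⟨c, hcn⟩, ha, hb', hb,
      hc', ?_, ?_⟩ <;> simpa
  have hlt : ∀ {q}, IsEnd n R q → ∀ {i : Fin n}, (i : ℕ) < q → e q i < n := by
    intro q hq i hi
    exact ((he q (hRn hq)).mem hi).1
  have hixlt : ∀ i : Fin n, (i : ℕ) < (x i : ℕ) + 1 := fun i => by
    have := hix i
    rw [Fin.le_def] at this
    omega
  set β : Fin n → Fin n := fun i => ⟨e (x i + 1) i, hlt (hxend i) (hixlt i)⟩ with hβdef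
  have hβv : ∀ i, (β i : ℕ) = e (x i + 1) i := fun i => rfl
  have hxsame : ∀ {i k}, SameCarrel R i k → x i = x k := by
    intro i k hs
    apply Fin.ext
    have h1 := (hxend i).lt_iff (hsx k)
    have h2 := (hxend k).lt_iff (hsx i)
    have h3 := (hxend i).lt_iff hs
    have h4 := (hxend k).lt_iff hs
    have h5 := hixlt i
    have h6 := hixlt k
    omega
  have hxle : ∀ {q}, IsEnd n R q → ∀ {i : Fin n}, (i : ℕ) < q → (x i : ℕ) + 1 ≤ q :=
    fun {_} hq {i} hi => (hq.lt_iff (hsx i)).1 hi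
  have hup : IsUpper β := by
    intro i
    have hi := i.isLt
    have := (he _ (hRn (hxend i))).add_le (i := ⟨0, by omega⟩) (k := i)
      (by rw [Fin.le_def]; exact Nat.zero_le _) (hixlt i)
    rw [Fin.le_def, hβv]
    dsimp only at this
    omega
  have hinc : IsCarrelIncreasing R β := by
    intro i k hik hs
    rw [Fin.lt_def, hβv, hβv, hxsame hs]
    exact (he _ (hRn (hxend k))).1 i k hik (hixlt k)
  have hflag : HasFlagCriticalList R β := by
    intro i j hi hj
    obtain ⟨hk1, hk2⟩ := nextCritical_mem R β j
    set k := nextCritical R β j with hk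
    have hik : i < k := by rw [Fin.le_def] at hk1; rw [Fin.lt_def]; omega
    have hxi : (x i : ℕ) = i := by
      have := IsCarrelEnd.le_of_sameCarrel (Or.inl hi) (hsx i)
      exact congrArg Fin.val (le_antisymm this (hix i))
    have hq : IsEnd n R (i + 1) := Or.inl hi
    have hQ := hxend k
    have hqQ : (i : ℕ) + 1 ≤ x k + 1 := by
      have := hixlt k
      rw [Fin.lt_def] at hik
      omega
    have heq := he _ (hRn hq)
    have heQ := he _ (hRn hQ)
    by_contra hcon
    rw [not_le, Fin.lt_def, hβv, hβv, hxi] at hcon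
    -- Since `k` is critical, the excess rises strictly after it, so the value β_k + 1 is skipped.
    -- It serves as the "2" of a 312 pattern whose "3" is β_i.
    have hc : e (x k + 1) k + 1 ∉ B (x k + 1) := by
      intro hmem
      obtain ⟨l, hl1, hl2⟩ := (heQ.2 _).1 hmem
      have hkl : k < l := by
        by_contra hkl
        have h1 := heQ.add_le (not_lt.1 hkl) (hixlt k)
        have h2 := not_lt.1 hkl
        rw [Fin.le_def] at h2
        omega
      have hs : SameCarrel R k l :=
        ((hsx k).of_le_of_le hkl.le (by rw [Fin.le_def]; omega)).1
      have h1 := hk2.excess_lt l hkl hs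
      unfold excess at h1
      rw [hβv, hβv, ← hxsame hs, hl2] at h1
      rw [Fin.lt_def] at hkl
      omega
    have hai : e (i + 1) i ∈ B (i + 1) := heq.mem (Nat.lt_succ_self _)
    have hne : e (i + 1) i ≠ e (x k + 1) k + 1 := fun h => hc (h ▸ hBmono hqQ hai)
    have hltk : ∀ {a : Fin n}, a ≤ i → (a : ℕ) < x k + 1 := fun ha => by
      rw [Fin.le_def] at ha; omega
    -- The "1" of the pattern: if the smallest i + 1 elements of the larger set were all in the
    -- smaller one, then β_i would be less than β_k.
    have hex : ∃ z ≤ i, e (x k + 1) z ∉ B (i + 1) := by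
      by_contra! hall
      have h1 := heq.le_of_mem (i := i)
        (fun a b hab hb => heQ.1 a b hab (hltk hb)) hall
      have h2 := heQ.1 i k hik (hixlt k)
      omega
    obtain ⟨z, hz1, hz2⟩ := hex
    have h2 := heQ.1 z k (hz1.trans_lt hik) (hixlt k)
    exact havoid hq hQ hqQ hai (heQ.mem (hltk hz1)) hz2 hc (by omega) (by omega)
  have hkey : ∀ q, IsEnd n R q → ∀ i : Fin n, (i : ℕ) < q → keyEntry β q i = e q i := by
    intro q hq i hi
    have heq := he q (hRn hq)
    apply le_antisymm
    -- `k` ends the run of consecutive values starting at `e q i`, so `e q k + 1` is missing from `B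
    -- q`. If β_k exceeded `e q k`, this gap would be the "2" of a 312 pattern.
    · have hne : (Finset.univ.filter fun k : Fin n => i ≤ k ∧ (k : ℕ) < q ∧
          e q k + i = e q i + k).Nonempty := ⟨i, by simp [hi]⟩
      obtain ⟨k, hk⟩ : ∃ k, k = Finset.max' _ hne := ⟨_, rfl⟩
      have hk1 : i ≤ k ∧ (k : ℕ) < q ∧ e q k + i = e q i + k := by
        rw [hk]; exact (Finset.mem_filter.1 (Finset.max'_mem _ hne)).2
      have hk2 : ∀ z : Fin n, i ≤ z → (z : ℕ) < q → e q z + i = e q i + z → z ≤ k :=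
        fun z h1 h2 h3 => by rw [hk]; exact Finset.le_max' _ _ (by simp [h1, h2, h3])
      suffices hs : (β k : ℕ) ≤ e q k by
        have := keyEntry_add_le hup hk1.1 hk1.2.1
        omega
      rw [hβv]
      have hp := hxend k
      have hep := he _ (hRn hp)
      have hpq := hxle hq hk1.2.1
      have hkp := hixlt k
      by_contra hcon
      have hcon := not_le.1 hcon
      have hltq : ∀ {a : Fin n}, a ≤ k → (a : ℕ) < q := fun ha => by
        rw [Fin.le_def] at ha; omega
      have hex : ∃ z ≤ k, e q z ∉ B (x k + 1) := by
        by_contra! hall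
        have := hep.le_of_mem (i := k) (fun a b hab hb => heq.1 a b hab (hltq hb)) hall
        omega
      obtain ⟨z, hz1, hz2⟩ := hex
      have hc : e q k + 1 ∉ B q := by
        intro hmem
        obtain ⟨l, hl1, hl2⟩ := (heq.2 _).1 hmem
        have hkl : k < l := by
          by_contra hkl
          have h1 := heq.add_le (not_lt.1 hkl) hk1.2.1
          have h2 := not_lt.1 hkl
          rw [Fin.le_def] at h2
          omega
        have h1 := heq.add_le hkl.le hl1
        have h2 := hk2 l (hk1.1.trans hkl.le) hl1 (by rw [Fin.lt_def] at hkl; omega)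
        exact absurd h2 (not_le.2 hkl)
      have ha := hep.mem hkp
      have hne' : e (x k + 1) k ≠ e q k + 1 := fun h => hc (h ▸ hBmono hpq ha)
      have hzk : e q z ≤ e q k := by
        rcases hz1.eq_or_lt with rfl | h
        · exact le_rfl
        · exact (heq.1 z k h hk1.2.1).le
      exact havoid hp hq hpq ha (heq.mem (hltq hz1)) hz2 hc (by omega) (by omega)
    · obtain ⟨k, hk1, hk2, hk3⟩ := exists_keyEntry (β := β) hi
      have h1 := heq.add_le hk1 hk2
      have hpq := hxle hq hk2
      have hltp : ∀ {a : Fin n}, a ≤ k → (a : ℕ) < x k + 1 := fun ha => by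
        have := hixlt k
        rw [Fin.le_def] at ha
        omega
      have hep := he _ (hRn (hxend k))
      have h2 := heq.le_of_mem (i := k) (fun a b hab hb => hep.1 a b hab (hltp hb))
        fun a ha => hBmono hpq (hep.mem (hltp ha))
      rw [← hβv] at h2
      omega
  refine ⟨β, ⟨⟨hup, hflag⟩, hinc⟩, fun q hq i => ?_⟩
  have h1 : (π i : ℕ) ∈ keySet β q ↔ (π i : ℕ) ∈ B q := by
    rw [(he q (hRn hq)).2]
    refine exists_congr fun k => and_congr_right fun hk => ?_
    rw [hkey q hq k hk]
  rw [h1, hmemB]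
  simp

theorem ncard_isGapless {R : Set ℕ} (hR : ∀ q ∈ R, q < n) :
    {β : Fin n → Fin n | IsGapless R β}.ncard = parabolicCatalan n R := by
  unfold parabolicCatalan
  have hex : ∀ β : Fin n → Fin n, IsGapless R β → ∃ π, IsRPermutation R π ∧ IsKeyOf R π β :=
    fun β hβ => hβ.1.exists_isKeyOf hR
  choose f hf1 hf2 using hex
  refine Set.ncard_congr f ?_ ?_ ?_
  · exact fun β hβ => ⟨hf1 β hβ, (hf2 β hβ).not_contains312 hβ.1⟩
  · intro β β' hβ hβ' h
    exact IsKeyOf.right_unique hβ hβ' (hf2 β hβ) (h ▸ hf2 β' hβ')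
  · rintro π ⟨hπ, h312⟩
    obtain ⟨β, hβ, hkey⟩ := exists_gapless_of_not_contains312 hR h312
    exact ⟨β, hβ, IsKeyOf.left_unique hβ.1 (hf2 β hβ) hkey (hf1 β hβ) hπ⟩

/-! ### Row bound sums determine gapless tuples -/

/-- The content of a filling: the exponent of its monomial. -/
noncomputable def content {lam : Fin n → ℕ} (T : Filling lam) : Fin n →₀ ℕ :=
  ∑ i, ∑ c, Finsupp.single (T i c) 1

theorem prod_X_eq_monomial_content {lam : Fin n → ℕ} (T : Filling lam) :
    ∏ i, ∏ c, (X (T i c) : MvPolynomial (Fin n) ℤ) = monomial (content T) 1 := by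
  unfold content
  rw [monomial_sum_one]
  exact Finset.prod_congr rfl fun i _ => (monomial_sum_one _ _).symm

/-- Each coefficient counts tableaux, so nothing cancels. -/
theorem coeff_rowBoundSum_ne_zero {lam : Fin n → ℕ} {β : Fin n → Fin n} {d : Fin n →₀ ℕ} :
    coeff d (rowBoundSum lam β) ≠ 0 ↔ ∃ T ∈ rowBoundSet lam β, content T = d := by
  classical
  unfold rowBoundSum
  simp_rw [coeff_sum, prod_X_eq_monomial_content, coeff_monomial]
  rw [Finset.sum_boole, Nat.cast_ne_zero, Finset.card_ne_zero]
  constructor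
  · rintro ⟨T, hT⟩
    simp only [Finset.mem_filter, Finset.mem_univ, true_and] at hT
    exact ⟨T, hT⟩
  · rintro ⟨T, hT⟩
    exact ⟨T, by simpa using hT⟩

theorem weight_content {lam : Fin n → ℕ} (T : Filling lam) :
    Finsupp.weight (fun v : Fin n => (v : ℕ)) (content T) = ∑ i, ∑ c, (T i c : ℕ) := by
  unfold content
  simp [map_sum, Finsupp.weight_single]

/-- The largest tableau with row bounds `β`. -/
noncomputable def maxTableau {lam : Fin n → ℕ} (hlam : Antitone lam) {β : Fin n → Fin n}
    (hβ : IsUpper β) : Filling lam :=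
  fun i c => ⟨keyEntry β (colLength lam c) i,
    (keyEntry_le hβ ((lt_colLength_iff hlam i c).2 c.isLt)).trans_lt (β i).isLt⟩

theorem colLength_antitone (lam : Fin n → ℕ) : Antitone (colLength lam) := fun _ _ h =>
  Finset.card_le_card fun _ hi =>
    Finset.mem_filter.2 ⟨Finset.mem_univ _, h.trans_lt (Finset.mem_filter.1 hi).2⟩

theorem maxTableau_mem {lam : Fin n → ℕ} (hlam : Antitone lam) {β : Fin n → Fin n}
    (hβ : IsUpper β) : maxTableau hlam hβ ∈ rowBoundSet lam β := by
  refine ⟨⟨fun i c c' hcc => ?_, fun i i' c hc hc' hii => ?_⟩, fun i c => ?_⟩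
  · exact keyEntry_antitone hβ (colLength_antitone lam hcc) ((lt_colLength_iff hlam i c').2 c'.isLt)
  · exact (enumerates_keyEntry hβ _).1 i i' hii ((lt_colLength_iff hlam i' c).2 hc')
  · exact keyEntry_le hβ ((lt_colLength_iff hlam i c).2 c.isLt)

theorem le_maxTableau {lam : Fin n → ℕ} (hlam : Antitone lam) {β : Fin n → Fin n}
    (hβ : IsUpper β) {T : Filling lam} (hT : T ∈ rowBoundSet lam β) (i : Fin n)
    (c : Fin (lam i)) : T i c ≤ maxTableau hlam hβ i c := by
  obtain ⟨k, hk1, hk2, hk3⟩ := exists_keyEntry (β := β) ((lt_colLength_iff hlam i c).2 c.isLt)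
  have hc := (lt_colLength_iff hlam k c).1 hk2
  have h1 := hT.1.add_le hlam hk1 c.isLt hc
  have h2 := hT.2 k ⟨c, hc⟩
  change (T i c : ℕ) + _ ≤ _ at h1
  change (T i c : ℕ) ≤ keyEntry β (colLength lam c) i
  rw [Fin.le_def] at h2 hk1
  omega

/-- The largest tableau dominates every other entrywise, so it alone attains the maximal sum of
values. This sum is a weight of the monomial, so the polynomial singles out the content. -/
theorem content_maxTableau_eq {lam : Fin n → ℕ} (hlam : Antitone lam) {β β' : Fin n → Fin n}
    (hβ : IsUpper β) (hβ' : IsUpper β') (h : rowBoundSum lam β = rowBoundSum lam β') :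
    content (maxTableau hlam hβ) = content (maxTableau hlam hβ') := by
  have key : ∀ {β β' : Fin n → Fin n} (hβ : IsUpper β),
      rowBoundSum lam β = rowBoundSum lam β' →
      ∃ T ∈ rowBoundSet lam β', content T = content (maxTableau hlam hβ) := by
    intro β β' hβ h
    rw [← coeff_rowBoundSum_ne_zero, ← h, coeff_rowBoundSum_ne_zero]
    exact ⟨_, maxTableau_mem hlam hβ, rfl⟩
  have hle : ∀ {β : Fin n → Fin n} (hβ : IsUpper β) {T : Filling lam}, T ∈ rowBoundSet lam β →
      ∑ i, ∑ c, (T i c : ℕ) ≤ ∑ i, ∑ c, (maxTableau hlam hβ i c : ℕ) := fun hβ T hT =>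
    Finset.sum_le_sum fun i _ => Finset.sum_le_sum fun c _ => le_maxTableau hlam hβ hT i c
  obtain ⟨T, hT, hTc⟩ := key hβ h
  obtain ⟨T', hT', hTc'⟩ := key hβ' h.symm
  have h1 := weight_content T
  have h2 := weight_content T'
  rw [hTc, weight_content] at h1
  rw [hTc', weight_content] at h2
  have h3 := hle hβ' hT
  have h4 := hle hβ hT'
  have heq : ∑ i, ∑ c, (T i c : ℕ) = ∑ i, ∑ c, (maxTableau hlam hβ' i c : ℕ) := by omega
  rw [← hTc]
  congr 1
  funext i c
  have hpt : ∀ i c, (T i c : ℕ) ≤ (maxTableau hlam hβ' i c : ℕ) := le_maxTableau hlam hβ' hT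
  have h5 := (Finset.sum_eq_sum_iff_of_le fun i _ => Finset.sum_le_sum fun c _ =>
    hpt i c).1 heq i (Finset.mem_univ _)
  have h6 := (Finset.sum_eq_sum_iff_of_le fun c _ => hpt i c).1 h5 c (Finset.mem_univ _)
  exact Fin.ext h6

open Classical in
/-- The columns of the largest tableau that contain the value `v`. -/
noncomputable def columnsWith (lam : Fin n → ℕ) (β : Fin n → Fin n) (v : ℕ) : Finset ℕ :=
  -- The range only has to contain all column indices; empty columns have empty key sets.
  (Finset.range (∑ i, lam i)).filter fun c => v ∈ keySet β (colLength lam c)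

theorem mem_columnsWith {lam : Fin n → ℕ} (hlam : Antitone lam) {β : Fin n → Fin n} {v c : ℕ} :
    c ∈ columnsWith lam β v ↔ v ∈ keySet β (colLength lam c) := by
  classical
  unfold columnsWith
  rw [Finset.mem_filter, Finset.mem_range, and_iff_right_iff_imp]
  rintro ⟨i, hi, -⟩
  exact ((lt_colLength_iff hlam i c).1 hi).trans_le
    (Finset.single_le_sum (f := lam) (fun _ _ => Nat.zero_le _) (Finset.mem_univ i))

theorem content_maxTableau_apply {lam : Fin n → ℕ} (hlam : Antitone lam) {β : Fin n → Fin n}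
    (hβ : IsUpper β) (v : Fin n) :
    content (maxTableau hlam hβ) v = (columnsWith lam β v).card := by
  classical
  have h1 : content (maxTableau hlam hβ) v = (Finset.univ.filter fun p : (i : Fin n) × Fin (lam i) =>
      maxTableau hlam hβ p.1 p.2 = v).card := by
    unfold content
    rw [Finset.card_filter, Fintype.sum_sigma]
    simp [Finsupp.finsetSum_apply, Finsupp.single_apply]
  rw [h1]
  refine Finset.card_bij (fun p _ => (p.2 : ℕ)) ?_ ?_ ?_
  · rintro ⟨i, c⟩ hp
    rw [Finset.mem_filter] at hp
    rw [mem_columnsWith hlam]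
    exact ⟨i, (lt_colLength_iff hlam i c).2 c.isLt, congrArg Fin.val hp.2⟩
  · rintro ⟨i, c, hc⟩ hp ⟨i', c', hc'⟩ hp' hcc
    rw [Finset.mem_filter] at hp hp'
    dsimp only at hcc
    subst hcc
    have h2 : keyEntry β (colLength lam c) i = keyEntry β (colLength lam c) i' :=
      congrArg Fin.val (hp.2.trans hp'.2.symm)
    have he := enumerates_keyEntry hβ (colLength lam c)
    have hii : i = i' := by
      rcases lt_trichotomy i i' with h | h | h
      · exact absurd h2 (he.1 i i' h ((lt_colLength_iff hlam i' c).2 hc')).ne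
      · exact h
      · exact absurd h2 (he.1 i' i h ((lt_colLength_iff hlam i c).2 hc)).ne'
    subst hii
    rfl
  · intro c hc
    rw [mem_columnsWith hlam] at hc
    obtain ⟨i, hi, h⟩ := hc
    exact ⟨⟨i, c, (lt_colLength_iff hlam i c).1 hi⟩, by
      rw [Finset.mem_filter]; exact ⟨Finset.mem_univ _, Fin.ext h⟩, rfl⟩

theorem finset_eq_range_card {s : Finset ℕ} (h : ∀ a ∈ s, ∀ b ≤ a, b ∈ s) :
    s = Finset.range s.card := by
  refine Finset.eq_of_subset_of_card_le (fun a ha => ?_) (by simp)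
  have h1 : Finset.range (a + 1) ⊆ s := fun b hb =>
    h a ha b (Nat.lt_succ_iff.1 (Finset.mem_range.1 hb))
  have h2 := Finset.card_le_card h1
  rw [Finset.card_range] at h2
  exact Finset.mem_range.2 h2

/-- Earlier columns are longer and key sets are nested, so the columns containing `v` form an
initial segment, determined by its size. -/
theorem columnsWith_eq_range {lam : Fin n → ℕ} (hlam : Antitone lam) {β : Fin n → Fin n}
    (hβ : IsGaplessCore (dividers lam) β) (v : ℕ) :
    columnsWith lam β v = Finset.range (columnsWith lam β v).card := by
  refine finset_eq_range_card fun c hc c' hcc => ?_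
  rw [mem_columnsWith hlam] at hc ⊢
  have hend : ∀ b ≤ c, IsEnd n (dividers lam) (colLength lam b) := by
    intro b hb
    obtain ⟨i, hi, -⟩ := hc
    rcases (colLength_le lam b).eq_or_lt with h | h
    · exact Or.inr h
    · exact Or.inl ⟨h, b, ⟨i, hb.trans_lt ((lt_colLength_iff hlam i c).1 hi)⟩, rfl⟩
  exact hβ.keySet_subset (hend c le_rfl) (hend c' hcc) (colLength_antitone lam hcc) hc

theorem IsGapless.eq_of_rowBoundSum_eq {lam : Fin n → ℕ} (hlam : Antitone lam)
    {β β' : Fin n → Fin n} (hβ : IsGapless (dividers lam) β) (hβ' : IsGapless (dividers lam) β')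
    (h : rowBoundSum lam β = rowBoundSum lam β') : β = β' := by
  refine eq_of_keySet_eq hβ.2 hβ'.2 hβ.1.1 hβ'.1.1 fun q hq => ?_
  ext v
  rcases hq with ⟨-, c, -, rfl⟩ | rfl
  · by_cases hv : v < n
    · have h1 := DFunLike.congr_fun (content_maxTableau_eq hlam hβ.1.1 hβ'.1.1 h) ⟨v, hv⟩
      rw [content_maxTableau_apply, content_maxTableau_apply] at h1
      rw [← mem_columnsWith hlam, ← mem_columnsWith hlam, columnsWith_eq_range hlam hβ.1 v,
        columnsWith_eq_range hlam hβ'.1 v]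
      dsimp only at h1
      rw [h1]
    · exact iff_of_false (fun hm => hv (lt_of_mem_keySet hβ.1.1 hm))
        (fun hm => hv (lt_of_mem_keySet hβ'.1.1 hm))
  · rw [mem_keySet_full hβ.1.1, mem_keySet_full hβ'.1.1]

/-! ### Maximum efficiency -/

theorem IsGapless.isBoundedByPlatform {R : Set ℕ} {β : Fin n → Fin n} (h : IsGapless R β) :
    IsBoundedByPlatform R β := by
  rw [← h.2.core_eq h.1.1]
  exact isBoundedByPlatform_core h.1.1

theorem IsGaplessCore.isGapless_core {R : Set ℕ} {β : Fin n → Fin n} (h : IsGaplessCore R β) :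
    IsGapless R (GVInput.core R β) :=
  ⟨h.core, isCarrelIncreasing_core h.1⟩

/-- The core of η is a rival with the same polynomial and no more monomials, so a most efficient η
equals its core. Conversely, the core of any rival of a gapless η is gapless with the same
polynomial, hence equals η and lies below the rival. -/
theorem attainsMaxEfficiency_iff {lam : Fin n → ℕ} (hlam : Antitone lam) (η : Fin n → Fin n) :
    AttainsMaxEfficiency lam η ↔ IsGapless (dividers lam) η := by
  constructor
  · rintro ⟨⟨hg, hb⟩, hmin⟩
    have hc := hg.isGapless_core
    by_cases hne : core (dividers lam) η = η
    · rwa [hne] at hc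
    · exfalso
      refine absurd (hmin _ hc.1 hc.isBoundedByPlatform hne ?_)
        (not_lt.2 (monomialCount_le (core_le hg.1)))
      rw [det_gvMatrix_eq_rowBoundSum hlam hc.1 hc.isBoundedByPlatform, rowBoundSum_core hlam hb]
  · intro h
    refine ⟨⟨h.1, h.isBoundedByPlatform⟩, fun η' hg hb hne hdet => ?_⟩
    rw [det_gvMatrix_eq_rowBoundSum hlam hg hb, ← rowBoundSum_core hlam hb] at hdet
    have heq := IsGapless.eq_of_rowBoundSum_eq hlam hg.isGapless_core h hdet
    refine monomialCount_lt h.1.1 (fun i => ?_) hne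
    rw [← heq]
    exact core_le hg.1 i

end GVInput

theorem corollary8p4 (n : ℕ) (hn : 1 ≤ n) (lam : Fin n → ℕ) (hlam : Antitone lam) :
    {η : Fin n → Fin n | GVInput.IsValidInput lam η ∧ GVInput.AttainsMaxEfficiency lam η}.ncard =
      GVInput.parabolicCatalan n (GVInput.dividers lam) := by
  rw [← GVInput.ncard_isGapless (R := GVInput.dividers lam) fun q hq => hq.1]
  congr 1
  ext η
  rw [Set.mem_ofPred_eq, Set.mem_ofPred_eq, GVInput.attainsMaxEfficiency_iff hlam]
  exact ⟨fun h => h.2, fun h =>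
    ⟨⟨h.1.1, GVInput.nonpermutable hlam h.1 h.isBoundedByPlatform⟩, h⟩⟩
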